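/- Let $k\ge 1$ and $g=2k+1$, and work over $\mathbb C$. **The curves.** For $t\in\mathbb C\setminus\{0\}$ let $C_t$ be the $A_{2g+1}$-rational curve with crimping $y\mapsto x-tx^{k+2}$: it is obtained from two copies of $\mathbb P^1$ with coordinates $x$ and $y$ by gluing the subschemes $x^{g+1}=0$ and $y^{g+1}=0$ along the isomorphism $\mathbb C[y]/(y^{g+1})\to\mathbb C[x]/(x^{g+1})$, $y\mapsto x-tx^{k+2}$. For $\kappa\in\mathbb C[x]/(x^{g+1})$ with constant term $1$, the line bundle $(\mathcal O(d),\mathcal O(d),\kappa)$ on $C_t$ has as global sections the pairs $(p(x),q(y))$ of polynomials of degree at most $d$ with $p(x)\equiv\kappa\, q(x-tx^{k+2})$ modulo $x^{g+1}$. The dualizing bundle $\omega_{C_t}$ is the unique bundle $(\mathcal O(g-1),\mathcal O(g-1),\kappa)$ having a $g$-dimensional space of global sections. **The ribbon.** Let $R$ be the balanced ribbon of genus $g$, obtained by gluing $\operatorname{Spec}\mathbb C[u,\epsilon]/(\epsilon^2)$ and $\operatorname{Spec}\mathbb C[v,\eta]/(\eta^2)$ along the isomorphism $$u\mapsto v^{-1}+v^{-k-2}\eta,\qquad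 \epsilon\mapsto v^{-g-1}\eta$$ of $\mathbb C[u,u^{-1},\epsilon]/(\epsilon^2)$ with $\mathbb C[v,v^{-1},\eta]/(\eta^2)$. Its dualizing bundle $\omega_R$ is trivialised on the two charts by $du\wedge d\epsilon/\epsilon^2$ and $dv\wedge d\eta/\eta^2$. **Statement.** 1. For every $t\neq 0$, the dualizing bundle $\omega_{C_t}$ is given by $\kappa=1+tk\,x^{k+1}$, and by no other $\kappa$ with constant term $1$. The sections $$\omega_i=(x^i+t(k-i)x^{k+1+i},\,y^i)\ (0\le i\le k-1),\qquad \omega_i=(x^i,y^i)\ (k\le i\le 2k)$$ form a basis of $H^0(C_t,\omega_{C_t})$. They define a projectively normal embedding $C_t\subset\mathbb P^{g-1}$: for every $m\ge 0$ the forms of degree $m$ in the $\omega_i$ fill up $H^0(C_t,\omega_{C_t}^{m})$. 2. There is a basis $z_0,\dots,z_{2k}$ of $H^0(R,\omega_R)$ that likewise defines a projectively normal embedding $R\subset\mathbb P^{g-1}$, such that $R$ is the flat limit of the curves $C_t$ as $t\to0$. That is, there is a homogeneous ideal $J\subset\mathbb C[t][Z_0,\dots,Z_{2k}]$ such that $\mathbb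 C[t][Z_0,\dots,Z_{2k}]/J$ is flat over $\mathbb C[t]$, the specialization of $J$ at $t=a$ is the homogeneous ideal of $C_a\subset\mathbb P^{g-1}$ for every $a\neq 0$, and the specialization of $J$ at $t=0$ is the homogeneous ideal of $R\subset\mathbb P^{g-1}$. Here the homogeneous ideals are those generated by the forms that vanish on the $\omega_i$, respectively on the $z_i$. -/

import Mathlib

open Polynomial LaurentPolynomial DualNumber

noncomputable section

namespace CanonicalRibbon

/-! ### Ideals of projectively embedded schemes and flat limits -/

/-- Let `s₀, …, s_{n-1}` be sections of a line bundle `L` on a scheme, written in local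
trivialisations of `L` on charts whose coordinate rings have product `B`. A form `F` of degree `m`
pulls back to the section `F(s₀, …, s_{n-1})` of `Lᵐ`; the ideal generated by the forms that pull
back to zero is the homogeneous ideal of the (scheme-theoretic) image in `ℙⁿ⁻¹`. -/
def imageIdeal {n : ℕ} {B : Type*} [CommRing B] [Algebra ℂ B] (s : Fin n → B) :
    Ideal (MvPolynomial (Fin n) ℂ) :=
  Ideal.span {F | (∃ m : ℕ, F.IsHomogeneous m) ∧ MvPolynomial.aeval s F = 0}

/-- `H m` is the space of global sections of `ωᵐ` (written on charts whose coordinate rings have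
product `B`), for an ample line bundle `ω`. The sections `s` are a basis of `H⁰(ω)`, and they
define a projectively normal embedding: the forms of degree `m` in the `sᵢ` fill up `H⁰(ωᵐ)` for
every `m`, so that the homogeneous coordinate ring of the image is the whole section ring
`⨁ₘ H⁰(ωᵐ)`. -/
structure IsNormalEmbedding {n : ℕ} {B : Type*} [CommRing B] [Algebra ℂ B] (s : Fin n → B)
    (H : ℕ → Submodule ℂ B) : Prop where
  linearIndependent : LinearIndependent ℂ s
  span_eq : Submodule.span ℂ (Set.range s) = H 1
  map_forms : ∀ m : ℕ,
    (MvPolynomial.homogeneousSubmodule (Fin n) ℂ m).map (MvPolynomial.aeval s).toLinearMap = H m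

/-- `I₀` is the flat limit, as `t → 0`, of the closed subschemes of `ℙⁿ⁻¹` with homogeneous ideals
`I t`, `t ≠ 0`: there is a homogeneous ideal `J` of `ℂ[t][z₀, …, z_{n-1}]` (a closed subscheme of
`ℙⁿ⁻¹ × 𝔸¹`) whose homogeneous coordinate ring is flat over `ℂ[t]`, whose fibre over every
`a ≠ 0` is `I a` and whose fibre over `0` is `I₀`. -/
def IsFlatLimit {n : ℕ} (I : ℂ → Ideal (MvPolynomial (Fin n) ℂ))
    (I₀ : Ideal (MvPolynomial (Fin n) ℂ)) : Prop :=
  ∃ J : Ideal (MvPolynomial (Fin n) ℂ[X]),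
    (∀ F ∈ J, ∀ m : ℕ, MvPolynomial.homogeneousComponent m F ∈ J) ∧
    Module.Flat ℂ[X] (MvPolynomial (Fin n) ℂ[X] ⧸ J) ∧
    (∀ a : ℂ, a ≠ 0 → J.map (MvPolynomial.map (Polynomial.evalRingHom a)) = I a) ∧
    J.map (MvPolynomial.map (Polynomial.evalRingHom 0)) = I₀

/-! ### `A_{2g+1}`-rational curves -/

/-- The ring `ℂ[x]/(x^{g+1})`. -/
abbrev Jet (g : ℕ) : Type := ℂ[X] ⧸ Ideal.span {(X : ℂ[X]) ^ (g + 1)}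

/-- The quotient map `ℂ[x] → ℂ[x]/(x^{g+1})`. -/
def jet (g : ℕ) : ℂ[X] →ₐ[ℂ] Jet g := Ideal.Quotient.mkₐ ℂ _

/-- A crimping `y ↦ a₁ x + a₂ x² + ⋯`, `a₁ ≠ 0`. It encodes the `A_{2g+1}`-rational curve `C`
obtained from two copies of `ℙ¹`, with coordinates `x` and `y`, by gluing the subschemes
`x^{g+1} = 0` and `y^{g+1} = 0` along the isomorphism `ℂ[y]/(y^{g+1}) → ℂ[x]/(x^{g+1})` that the
polynomial defines. Only its class modulo `x^{g+1}` matters. -/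
structure Crimping where
  poly : ℂ[X]
  coeff_zero : poly.coeff 0 = 0
  coeff_one : poly.coeff 1 ≠ 0

/-- The composite `ℂ[y] → ℂ[y]/(y^{g+1}) → ℂ[x]/(x^{g+1})` of the quotient map and the gluing
isomorphism. -/
def Crimping.glue (γ : Crimping) (g : ℕ) : ℂ[X] →ₐ[ℂ] Jet g := Polynomial.aeval (jet g γ.poly)

/-- Global sections of the line bundle `(𝒪(d), 𝒪(d), κ)` on the `A_{2g+1}`-rational curve with
crimping `γ`: a section is a pair of a section `p(x)` of `𝒪(d)` on the first copy of `ℙ¹` and a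
section `q(y)` of `𝒪(d)` on the second one (polynomials of degree at most `d`), matching at the
singular point through the gluing datum `κ` of the line bundle, that is
`p(x) = κ · q(γ(x))` in `ℂ[x]/(x^{g+1})`. -/
def Crimping.sections (γ : Crimping) (g d : ℕ) (κ : Jet g) : Submodule ℂ (ℂ[X] × ℂ[X]) where
  carrier := {s | s.1.degree ≤ d ∧ s.2.degree ≤ d ∧ jet g s.1 = κ * γ.glue g s.2}
  zero_mem' := by simp
  add_mem' := by
    rintro a b ⟨h1, h2, h3⟩ ⟨h4, h5, h6⟩
    refine ⟨(Polynomial.degree_add_le _ _).trans (max_le h1 h4),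
      (Polynomial.degree_add_le _ _).trans (max_le h2 h5), ?_⟩
    simp only [Prod.fst_add, Prod.snd_add, map_add, h3, h6, mul_add]
  smul_mem' := by
    rintro c a ⟨h1, h2, h3⟩
    refine ⟨(Polynomial.degree_smul_le _ _).trans h1, (Polynomial.degree_smul_le _ _).trans h2, ?_⟩
    simp only [Prod.smul_fst, Prod.smul_snd, map_smul, h3, mul_smul_comm]

/-- `κ = 1 + k₁ x + ⋯ + k_g x^g` (hence a unit) is the gluing datum of the dualizing line bundle
`ω_C = (𝒪(g-1), 𝒪(g-1), κ)`, the line bundle that restricts to `𝒪(g-1)` on both components and has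
a `g`-dimensional space of global sections. -/
def Crimping.IsCanonicalDatum (γ : Crimping) (g : ℕ) (κ : Jet g) : Prop :=
  (∃ r : Jet g, κ = 1 + jet g X * r) ∧ Module.finrank ℂ (γ.sections g (g - 1) κ) = g

/-- The crimping `y ↦ x - t x^{k+2}`. -/
def crimp (k : ℕ) (t : ℂ) : Crimping where
  poly := X - Polynomial.C t * X ^ (k + 2)
  coeff_zero := by simp
  coeff_one := by simp [Polynomial.coeff_X_pow]

/-- The sections `ωᵢ = (xⁱ + t (k - i) x^{k+1+i}, yⁱ)` for `i < k`, `ωᵢ = (xⁱ, yⁱ)` for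
`k ≤ i ≤ 2k`. -/
def omega (k : ℕ) (t : ℂ) (i : Fin (2 * k + 1)) : ℂ[X] × ℂ[X] :=
  if (i : ℕ) < k then
    (X ^ (i : ℕ) + Polynomial.C (t * ((k : ℂ) - (i : ℕ))) * X ^ (k + 1 + (i : ℕ)), X ^ (i : ℕ))
  else (X ^ (i : ℕ), X ^ (i : ℕ))

/-! ### The balanced ribbon -/

/-- The coordinate ring `ℂ[u, ε]/(ε²)` (or `ℂ[v, η]/(η²)`) of an affine chart of the ribbon. -/
abbrev Chart : Type := ℂ[X][ε]

/-- The coordinate ring `ℂ[u, u⁻¹, ε]/(ε²)` (or `ℂ[v, v⁻¹, η]/(η²)`) of the overlap. -/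
abbrev Overlap : Type := ℂ[T;T⁻¹][ε]

/-- Restriction from a chart to the overlap, `u ↦ u`, `ε ↦ ε`. -/
def restrict : Chart →ₐ[ℂ] Overlap :=
  DualNumber.lift ⟨((TrivSqZeroExt.inlAlgHom ℂ ℂ[T;T⁻¹] ℂ[T;T⁻¹]).comp
      ((Polynomial.toLaurentAlg (R := ℂ))), ε),
    DualNumber.eps_mul_eps, fun _ => DualNumber.commute_eps_left _⟩

theorem glueUnit_aux (k : ℕ) :
    (TrivSqZeroExt.inl (T (-1)) + TrivSqZeroExt.inr (T (-(k : ℤ) - 2)) : Overlap) *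
      (TrivSqZeroExt.inl (T 1) - TrivSqZeroExt.inr (T (-(k : ℤ)))) = 1 := by
  apply TrivSqZeroExt.ext
  · simp only [TrivSqZeroExt.fst_mul, TrivSqZeroExt.fst_add, TrivSqZeroExt.fst_sub,
      TrivSqZeroExt.fst_inl, TrivSqZeroExt.fst_inr, TrivSqZeroExt.fst_one, add_zero, sub_zero,
      ← T_add]
    simp
  · simp only [TrivSqZeroExt.snd_mul, TrivSqZeroExt.fst_add, TrivSqZeroExt.fst_sub,
      TrivSqZeroExt.snd_add, TrivSqZeroExt.snd_sub, TrivSqZeroExt.fst_inl, TrivSqZeroExt.fst_inr,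
      TrivSqZeroExt.snd_inl, TrivSqZeroExt.snd_inr, TrivSqZeroExt.snd_one, add_zero, sub_zero,
      zero_sub, zero_add, smul_eq_mul, MulOpposite.smul_eq_mul_unop, MulOpposite.unop_op, mul_neg,
      ← T_add]
    ring_nf

/-- The invertible function `v⁻¹ + v^{-k-2} η` on the overlap. -/
def glueUnit (k : ℕ) : Overlapˣ where
  val := TrivSqZeroExt.inl (T (-1)) + TrivSqZeroExt.inr (T (-(k : ℤ) - 2))
  inv := TrivSqZeroExt.inl (T 1) - TrivSqZeroExt.inr (T (-(k : ℤ)))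
  val_inv := glueUnit_aux k
  inv_val := by rw [mul_comm, glueUnit_aux]

/-- The homomorphism `ℂ[u, u⁻¹, ε]/(ε²) → ℂ[v, v⁻¹, η]/(η²)`, `u ↦ v⁻¹ + v^{-k-2} η`,
`ε ↦ v^{-g-1} η`, where `g = 2k + 1`. -/
def glueHom (k : ℕ) : Overlap →ₐ[ℂ] Overlap :=
  DualNumber.lift ⟨(AddMonoidAlgebra.lift ℂ Overlap ℤ
      ((Units.coeHom Overlap).comp (zpowersHom Overlapˣ (glueUnit k))),
      TrivSqZeroExt.inr (T (-(2 * (k : ℤ) + 1) - 1))),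
    TrivSqZeroExt.inr_mul_inr _ _ _, fun _ => Commute.all _ _⟩

theorem glueHom_inl_T (k : ℕ) (n : ℤ) :
    glueHom k (TrivSqZeroExt.inl (T n)) = ((glueUnit k ^ n : Overlapˣ) : Overlap) := by
  rw [glueHom, DualNumber.lift_apply_inl]
  change AddMonoidAlgebra.lift ℂ Overlap ℤ _ (AddMonoidAlgebra.single n 1) = _
  rw [AddMonoidAlgebra.lift_single, one_smul]
  rfl

theorem glueHom_inr (k : ℕ) (p : ℂ[T;T⁻¹]) :
    glueHom k (TrivSqZeroExt.inr p) =
      glueHom k (TrivSqZeroExt.inl p) * TrivSqZeroExt.inr (T (-(2 * (k : ℤ) + 1) - 1)) := by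
  rw [glueHom, DualNumber.lift_apply_apply, DualNumber.lift_apply_apply]
  simp

theorem fst_glueUnit_zpow (k : ℕ) (n : ℤ) :
    ((glueUnit k ^ n : Overlapˣ) : Overlap).fst = T (-n) := by
  obtain ⟨m, rfl | rfl⟩ := n.eq_nat_or_neg
  · rw [zpow_natCast, Units.val_pow_eq_pow_val, TrivSqZeroExt.fst_pow]
    simp [glueUnit, T_pow]
  · rw [zpow_neg, zpow_natCast, ← inv_pow, Units.val_pow_eq_pow_val, TrivSqZeroExt.fst_pow]
    change (TrivSqZeroExt.fst (TrivSqZeroExt.inl (T 1) - TrivSqZeroExt.inr (T (-(k : ℤ))))) ^ m = _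
    simp [T_pow]

theorem inl_T_mul_inl_T (a b : ℤ) :
    (TrivSqZeroExt.inl (T a) * TrivSqZeroExt.inl (T b) : Overlap) =
      TrivSqZeroExt.inl (T (a + b)) := by
  rw [← TrivSqZeroExt.inl_mul, T_add]

theorem fst_glueHom_inl_T (k : ℕ) (n : ℤ) :
    (glueHom k (TrivSqZeroExt.inl (T n))).fst = T (-n) := by
  rw [glueHom_inl_T, fst_glueUnit_zpow]

theorem glueHom_inr_T (k : ℕ) (n : ℤ) :
    glueHom k (TrivSqZeroExt.inr (T n)) =
      TrivSqZeroExt.inr (T (-n + (-(2 * (k : ℤ) + 1) - 1))) := by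
  rw [glueHom_inr]
  apply TrivSqZeroExt.ext
  · simp
  · rw [TrivSqZeroExt.snd_mul, fst_glueHom_inl_T]
    rw [TrivSqZeroExt.snd_inr, TrivSqZeroExt.fst_inr, MulOpposite.op_zero, zero_smul, add_zero,
      smul_eq_mul, TrivSqZeroExt.snd_inr, ← T_add]

theorem glueHom_glueUnit (k : ℕ) :
    glueHom k (glueUnit k : Overlap) = TrivSqZeroExt.inl (T 1) := by
  change glueHom k (TrivSqZeroExt.inl (T (-1)) + TrivSqZeroExt.inr (T (-(k : ℤ) - 2))) = _
  rw [map_add, glueHom_inl_T, glueHom_inr_T, zpow_neg, zpow_one]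
  change TrivSqZeroExt.inl (T 1) - TrivSqZeroExt.inr (T (-(k : ℤ))) + _ = _
  have : (-(-(k : ℤ) - 2) + (-(2 * (k : ℤ) + 1) - 1)) = -k := by ring
  rw [this, sub_add_cancel]

theorem glueHom_glueHom_inl_T (k : ℕ) (n : ℤ) :
    glueHom k (glueHom k (TrivSqZeroExt.inl (T n))) = TrivSqZeroExt.inl (T n) := by
  let w : Overlapˣ := ⟨TrivSqZeroExt.inl (T 1), TrivSqZeroExt.inl (T (-1)),
    by rw [inl_T_mul_inl_T]; simp, by rw [inl_T_mul_inl_T]; simp⟩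
  have hw : Units.map (glueHom k : Overlap →* Overlap) (glueUnit k) = w :=
    Units.ext (glueHom_glueUnit k)
  have h1 : glueHom k ((glueUnit k ^ n : Overlapˣ) : Overlap) = ((w ^ n : Overlapˣ) : Overlap) := by
    rw [← hw, ← map_zpow]; rfl
  rw [glueHom_inl_T, h1]
  obtain ⟨m, rfl | rfl⟩ := n.eq_nat_or_neg
  · rw [zpow_natCast, Units.val_pow_eq_pow_val]
    change (TrivSqZeroExt.inl (T 1)) ^ m = _
    rw [TrivSqZeroExt.inl_pow, T_pow, mul_one]
  · rw [zpow_neg, zpow_natCast, ← inv_pow, Units.val_pow_eq_pow_val]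
    change (TrivSqZeroExt.inl (T (-1))) ^ m = _
    rw [TrivSqZeroExt.inl_pow, T_pow, mul_neg_one]

theorem glueHom_comp_glueHom (k : ℕ) : (glueHom k).comp (glueHom k) = AlgHom.id ℂ Overlap := by
  have hT : ∀ p : ℂ[T;T⁻¹],
      glueHom k (glueHom k (TrivSqZeroExt.inl p)) = TrivSqZeroExt.inl p := by
    intro p
    induction p using LaurentPolynomial.induction_on' with
    | add p q hp hq => rw [TrivSqZeroExt.inl_add, map_add, map_add, hp, hq]
    | C_mul_T n a =>
      have : (LaurentPolynomial.C a * T n : ℂ[T;T⁻¹]) = a • T n := by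
        rw [LaurentPolynomial.smul_eq_C_mul]
      rw [this, TrivSqZeroExt.inl_smul, map_smul, map_smul, glueHom_glueHom_inl_T]
  refine AlgHom.ext fun x => ?_
  have hx : x = TrivSqZeroExt.inl x.fst + TrivSqZeroExt.inl x.snd * TrivSqZeroExt.inr (T 0) := by
    apply TrivSqZeroExt.ext <;> simp
  change glueHom k (glueHom k x) = x
  rw [hx, map_add, map_add, map_mul, map_mul, hT, hT, glueHom_inr_T, glueHom_inr_T]
  congr 4
  ring

/-- The gluing isomorphism `ℂ[u, u⁻¹, ε]/(ε²) ≃ ℂ[v, v⁻¹, η]/(η²)` of the balanced ribbon. It is an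
involution: its inverse is `v ↦ u⁻¹ + u^{-k-2} ε`, `η ↦ u^{-g-1} ε`. -/
def ribbonGlue (k : ℕ) : Overlap ≃ₐ[ℂ] Overlap :=
  AlgEquiv.ofAlgHom (glueHom k) (glueHom k) (glueHom_comp_glueHom k) (glueHom_comp_glueHom k)

/-- The derivative `d/dv` of Laurent polynomials. -/
def lderiv (p : ℂ[T;T⁻¹]) : ℂ[T;T⁻¹] :=
  p.coeff.sum fun n c => LaurentPolynomial.C ((n : ℂ) * c) * T (n - 1)

/-- For a change of coordinates `u = a + b η`, `ε = e η`, with `a, b, e` functions of `v` and `e`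
invertible with inverse `f`, the factor `c` in
`du ∧ dε / ε² = c · dv ∧ dη / η²`. Indeed
`du ∧ dε = ((a' + b' η) dv + b dη) ∧ (e' η dv + e dη) = (a' e + (b' e - b e') η) dv ∧ dη`
and `ε² = e² η²`. -/
def adjunctionFactor (a b f e : ℂ[T;T⁻¹]) : Overlap :=
  TrivSqZeroExt.inl (f * lderiv a) +
    TrivSqZeroExt.inr (f ^ 2 * (lderiv b * e - b * lderiv e))

/-- The transition function of the dualizing line bundle `ω_R` of the balanced ribbon of genus
`g = 2k + 1`. By adjunction `ω_R = (Ω² (2 R_red))|_R` for a (local) surface containing `R`, so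
`ω_R` is trivialised by `du ∧ dε / ε²` and by `dv ∧ dη / η²` on the two charts. -/
def ribbonOmega (k : ℕ) : Overlap :=
  adjunctionFactor (T (-1)) (T (-(k : ℤ) - 2)) (T (2 * (k : ℤ) + 1 + 1))
    (T (-(2 * (k : ℤ) + 1) - 1))

/-- Global sections of `ω_Rᵐ`: pairs `(f (du ∧ dε / ε²)ᵐ, h (dv ∧ dη / η²)ᵐ)` with
`f ∈ ℂ[u, ε]/(ε²)` and `h ∈ ℂ[v, η]/(η²)` that agree on the overlap. -/
def ribbonSections (k m : ℕ) : Submodule ℂ (Chart × Chart) where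
  carrier := {s | restrict s.2 = ribbonOmega k ^ m * ribbonGlue k (restrict s.1)}
  zero_mem' := by simp
  add_mem' := by
    intro a b ha hb
    simp only [Set.mem_ofPred_eq] at ha hb ⊢
    simp only [Prod.fst_add, Prod.snd_add, map_add, ha, hb, mul_add]
  smul_mem' := by
    intro c a ha
    simp only [Set.mem_ofPred_eq] at ha ⊢
    simp only [Prod.smul_fst, Prod.smul_snd, map_smul, ha, mul_smul_comm]

end CanonicalRibbon

end

/-!
All the objects are fibres of one explicit family. Over a commutative ring `R` with an element `t`
consider `Fam t = R[x][ε]/(ε² - tε)` and its elements `ω_i = x^i + max(k - i, 0) x^{k+1+i} ε`.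

* If `t = a ∈ ℂ` is nonzero, `f₀ + f₁ ε ↦ (f₀ + a f₁, f₀)` identifies `Fam a` with the pairs of
  polynomials, and the `ω_i` with the sections `omega k a i` (`toCurve`).
* If `t = 0`, then `ε² = 0`, and `x = u⁻¹`, together with a change of sign of `ε`, turns the
  `ω_i`, multiplied by `u^{2k}`, into sections of `ω_R` on the first chart of the ribbon
  (`toRibbon`).

The condition for `f₀ + f₁ ε` to be a section of the `m`-th power of the dualizing bundle turns
out to be independent of `t`: both components have degree at most `2km`, and
`f₁ ≡ x^{k+1} (mk f₀ - x f₀')` modulo `x^{2k+2}`. For the curves this is the gluing condition, because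
`κ^m q(x - t x^{k+2}) ≡ q + t x^{k+1} (mk q - x q')` (`mem_sections_iff`, `map_toCurve_famForms`); for the
ribbon it says that a section on the first chart has no pole on the second one
(`exists_famForms_of_mem_ribbonSections`). Let `famForms k t m` be the module so defined.

Projective normality is therefore proved once, over an arbitrary base: forms of degree `m` in the
`ω_i` fill up `famForms k t m` (`map_homogeneousSubmodule_famSection`). Modulo `ε` the `ω_i` are
the monomials `x^i`, so it suffices to produce the elements `x^j ε` with `2k + 2 ≤ j ≤ 2km`, and
those come from the quadrics `ω_i ω_j - ω_{i+1} ω_{j-1} = x^{k+1+i+j} ε`, `i < k < j`.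

For the flat limit take `R = ℂ[t]` and let `famIdeal k` be the homogeneous ideal of relations
between the `ω_i`. Its quotient embeds in the torsion-free module `(Fam t)[s]`, hence is flat over
`ℂ[t]`. If a form `F` over `ℂ` vanishes on the fibre over `a`, then `F(ω) = (t - a) w` over
`ℂ[t]`, and `w` lies in `famForms k t m` because the equations of that module are linear and do
not involve `t` (`mem_famForms_of_smul_mem`). So `w = G(ω)` for a form `G`, and `F - (t - a) G` is
a relation over `ℂ[t]` that specialises to `F`: the fibre of `famIdeal k` over every `a`, zero
included, is the ideal of all relations (`map_famIdeal`).

The gluing datum `κ` is determined because a `g`-dimensional space of sections means that every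
polynomial `q` of degree less than `g` is a second component, that is, that the coefficient of
`x^g` in `κ q(x - t x^{k+2})` vanishes for all of them; `q = 1, y, …, y^{2k}` give all
coefficients of `κ`.
-/

noncomputable section

namespace CanonicalRibbon

/-! ### The canonical family over an arbitrary base -/

theorem aeval_mul_of_isHomogeneous {σ R B : Type*} [CommRing R] [CommRing B] [Algebra R B] (c : B)
    (y : σ → B) {m : ℕ} {F : MvPolynomial σ R} (hF : F.IsHomogeneous m) :
    MvPolynomial.aeval (fun i => c * y i) F = c ^ m * MvPolynomial.aeval y F := by
  rw [MvPolynomial.aeval_def, MvPolynomial.eval₂_eq, MvPolynomial.aeval_def, MvPolynomial.eval₂_eq,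
    Finset.mul_sum]
  refine Finset.sum_congr rfl fun d hd => ?_
  simp only [mul_pow, Finset.prod_mul_distrib, Finset.prod_pow_eq_pow_sum]
  rw [← hF.degree_eq_sum_deg_support hd]
  ring

section Family

variable {R : Type*} [CommRing R]

/-- The ring `R[x][ε]/(ε² - tε)`. An element `f₀ + f₁ ε` stands for the pair of functions
`(f₀ + t f₁, f₀)` on two copies of the affine line when `t` is invertible, and it is a function on
the trivial ribbon over the line when `t = 0`. -/
abbrev Fam (t : R) : Type _ := QuadraticAlgebra R[X] 0 (Polynomial.C t)

/-- The section `xⁱ + (k - i) x^{k+1+i} ε` for `i < k`, and `xⁱ` for `i ≥ k`. The subtraction is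
the truncated one of `ℕ`, which makes the two cases one formula. -/
def famSection (k : ℕ) (t : R) (i : ℕ) : Fam t :=
  ⟨X ^ i, ((k - i : ℕ) : R[X]) * X ^ (k + 1 + i)⟩

/-- The sections of the `m`-th power of the canonical bundle of the family: the elements
`f₀ + f₁ ε` of degree at most `2km` such that `f₁ ≡ x^{k+1} (mk f₀ - x f₀')` modulo `x^{2k+2}`.
These conditions do not involve `t`. -/
def famForms (k : ℕ) (t : R) (m : ℕ) : Submodule R (Fam t) where
  carrier := {w | w.re.degree ≤ ((m * (2 * k) : ℕ) : WithBot ℕ) ∧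
    w.im.degree ≤ ((m * (2 * k) : ℕ) : WithBot ℕ) ∧
    X ^ (2 * k + 2) ∣
      w.im - X ^ (k + 1) * (((m * k : ℕ) : R[X]) * w.re - X * derivative w.re)}
  zero_mem' := by simp
  add_mem' := by
    rintro a b ⟨h1, h2, h3⟩ ⟨h4, h5, h6⟩
    refine ⟨(degree_add_le _ _).trans (max_le h1 h4), (degree_add_le _ _).trans (max_le h2 h5), ?_⟩
    convert dvd_add h3 h6 using 1
    simp only [QuadraticAlgebra.re_add, QuadraticAlgebra.im_add, derivative_add]
    ring
  smul_mem' := by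
    rintro c a ⟨h1, h2, h3⟩
    refine ⟨(degree_smul_le _ _).trans h1, (degree_smul_le _ _).trans h2, ?_⟩
    convert dvd_mul_of_dvd_right h3 (Polynomial.C c) using 1
    simp only [QuadraticAlgebra.re_smul, QuadraticAlgebra.im_smul, Polynomial.smul_eq_C_mul,
      derivative_C_mul]
    ring

theorem mem_famForms {k : ℕ} {t : R} {m : ℕ} {w : Fam t} :
    w ∈ famForms k t m ↔ w.re.degree ≤ ((m * (2 * k) : ℕ) : WithBot ℕ) ∧
      w.im.degree ≤ ((m * (2 * k) : ℕ) : WithBot ℕ) ∧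
      X ^ (2 * k + 2) ∣
        w.im - X ^ (k + 1) * (((m * k : ℕ) : R[X]) * w.re - X * derivative w.re) := Iff.rfl

theorem coeff_X_pow_mul_X_derivative (k N : ℕ) (f : R[X]) (n : ℕ) :
    (X ^ (k + 1) * ((N : R[X]) * f - X * derivative f)).coeff n =
      if k + 1 ≤ n then ((N : R) - (n - (k + 1) : ℕ)) * f.coeff (n - (k + 1)) else 0 := by
  rw [mul_comm, coeff_mul_X_pow']
  split_ifs with h
  · rw [coeff_sub, ← Polynomial.C_eq_natCast, coeff_C_mul]
    rcases n - (k + 1) with _ | j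
    · simp
    · rw [coeff_X_mul, coeff_derivative]
      push_cast
      ring
  · rfl

/-- The congruence that defines `famForms`, in terms of coefficients. -/
theorem mem_famForms_iff_coeff {k : ℕ} {t : R} {m : ℕ} {w : Fam t} :
    w ∈ famForms k t m ↔ (∀ n, m * (2 * k) < n → w.re.coeff n = 0) ∧
      (∀ n, m * (2 * k) < n → w.im.coeff n = 0) ∧
      ∀ n < 2 * k + 2, w.im.coeff n =
        if k + 1 ≤ n then (((m * k : ℕ) : R) - (n - (k + 1) : ℕ)) * w.re.coeff (n - (k + 1))
          else 0 := by
  rw [mem_famForms, degree_le_iff_coeff_zero, degree_le_iff_coeff_zero, X_pow_dvd_iff]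
  simp only [coeff_sub, coeff_X_pow_mul_X_derivative, sub_eq_zero, Nat.cast_lt]

theorem degree_mul_le_of_add_eq {f g : R[X]} {a b c : ℕ} (hf : f.degree ≤ (a : WithBot ℕ))
    (hg : g.degree ≤ (b : WithBot ℕ)) (h : a + b = c) : (f * g).degree ≤ (c : WithBot ℕ) := by
  subst h
  push_cast
  exact (degree_mul_le _ _).trans (add_le_add hf hg)

/-- The operator `f₀ ↦ mk f₀ - x f₀'` obeys a Leibniz rule in which the weights `m` add up, and the
term `t f₁ g₁` of a product is divisible by `x^{2k+2}`. -/
theorem famForms_mul_le (k : ℕ) (t : R) (m n : ℕ) :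
    famForms k t m * famForms k t n ≤ famForms k t (m + n) := by
  rw [Submodule.mul_le]
  rintro a ⟨ha1, ha2, ca, ha3⟩ b ⟨hb1, hb2, cb, hb3⟩
  have hd : m * (2 * k) + n * (2 * k) = (m + n) * (2 * k) := by ring
  refine ⟨?_, ?_, ?_⟩
  · rw [QuadraticAlgebra.re_mul, zero_mul, zero_mul, add_zero]
    exact degree_mul_le_of_add_eq ha1 hb1 hd
  · rw [QuadraticAlgebra.im_mul, mul_assoc, ← Polynomial.smul_eq_C_mul]
    refine (degree_add_le _ _).trans (max_le ((degree_add_le _ _).trans (max_le ?_ ?_)) ?_)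
    · exact degree_mul_le_of_add_eq ha1 hb2 hd
    · exact degree_mul_le_of_add_eq ha2 hb1 hd
    · exact (degree_smul_le _ _).trans (degree_mul_le_of_add_eq ha2 hb2 hd)
  · rw [sub_eq_iff_eq_add] at ha3 hb3
    rw [QuadraticAlgebra.im_mul, QuadraticAlgebra.re_mul, ha3, hb3]
    set p := a.re
    set q := b.re
    refine ⟨p * cb + ca * q + Polynomial.C t *
      ((X ^ (k + 1) * ca + (((m * k : ℕ) : R[X]) * p - X * derivative p)) *
        (X ^ (k + 1) * cb + (((n * k : ℕ) : R[X]) * q - X * derivative q))), ?_⟩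
    simp only [zero_mul, add_zero, derivative_mul]
    push_cast
    ring

theorem re_sum {t : R} {ι : Type*} (s : Finset ι) (f : ι → Fam t) :
    (∑ i ∈ s, f i).re = ∑ i ∈ s, (f i).re :=
  map_sum (QuadraticAlgebra.reₗ (a := (0 : R[X])) (b := Polynomial.C t)) f s

theorem im_sum {t : R} {ι : Type*} (s : Finset ι) (f : ι → Fam t) :
    (∑ i ∈ s, f i).im = ∑ i ∈ s, (f i).im :=
  map_sum (QuadraticAlgebra.imₗ (a := (0 : R[X])) (b := Polynomial.C t)) f s

/-- For `m = 1` the congruence modulo `x^{2k+2}` determines `f₁` completely, as `f₁` has degree at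
most `2k`. -/
theorem famForms_one (k : ℕ) (t : R) :
    famForms k t 1 =
      Submodule.span R (Set.range fun i : Fin (2 * k + 1) => famSection k t i) := by
  apply le_antisymm
  · intro w hw
    rw [mem_famForms_iff_coeff] at hw
    obtain ⟨h1, h2, h3⟩ := hw
    have hre := w.re.as_sum_range_C_mul_X_pow' (n := 2 * k + 1) (by
      rw [Nat.lt_succ_iff, natDegree_le_iff_coeff_eq_zero]
      exact fun n hn => h1 n (by omega))
    have : w = ∑ i ∈ Finset.range (2 * k + 1), w.re.coeff i • famSection k t i := by
      refine QuadraticAlgebra.ext ?_ ?_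
      · rw [re_sum]
        simpa [famSection, Polynomial.smul_eq_C_mul] using hre
      · rw [im_sum]
        ext n
        simp only [famSection, QuadraticAlgebra.im_smul, finsetSum_coeff, coeff_smul,
          ← Polynomial.C_eq_natCast, coeff_C_mul, coeff_X_pow, smul_eq_mul]
        rcases lt_or_ge (2 * k) n with hn | hn
        · rw [h2 n (by omega), Finset.sum_eq_zero]
          intro i _
          split_ifs with h
          · rw [Nat.sub_eq_zero_of_le (by omega)]
            simp
          · simp
        · rw [h3 n (by omega)]
          split_ifs with h
          · rw [Finset.sum_eq_single (n - (k + 1))]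
            · rw [if_pos (by omega), one_mul, Nat.cast_sub (show n - (k + 1) ≤ k by omega)]
              ring
            · intro i _ hi
              rw [if_neg (by omega)]
              simp
            · intro hn'
              exact absurd (Finset.mem_range.2 (by omega)) hn'
          · rw [Finset.sum_eq_zero]
            intro i _
            rw [if_neg (by omega)]
            simp
    rw [this]
    exact Submodule.sum_mem _ fun i hi => Submodule.smul_mem _ _ (Submodule.subset_span
      ⟨⟨i, Finset.mem_range.1 hi⟩, rfl⟩)
  · rw [Submodule.span_le]
    rintro _ ⟨⟨i, hi⟩, rfl⟩
    change famSection k t i ∈ famForms k t 1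
    rw [mem_famForms_iff_coeff]
    simp only [famSection, ← Polynomial.C_eq_natCast, coeff_C_mul, coeff_X_pow]
    refine ⟨fun n hn => if_neg (by omega), fun n hn => ?_, fun n hn => ?_⟩
    · rcases Nat.lt_or_ge i k with h | h
      · rw [if_neg (by omega), mul_zero]
      · rw [Nat.sub_eq_zero_of_le h, Nat.cast_zero, zero_mul]
    · split_ifs with h1 h2 h3 <;> try omega
      · have : n - (k + 1) = i := by omega
        rw [this, one_mul]
        rcases Nat.lt_or_ge i k with h | h
        · rw [Nat.cast_sub h.le]
        · have : i = k := by omega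
          simp [this]
      all_goals simp

theorem famSection_mem_famForms (k : ℕ) (t : R) {i : ℕ} (hi : i ≤ 2 * k) :
    famSection k t i ∈ famForms k t 1 := by
  rw [famForms_one]
  exact Submodule.subset_span ⟨⟨i, by omega⟩, rfl⟩

theorem exists_re_eq_X_pow (k : ℕ) (t : R) (m : ℕ) :
    ∀ n ≤ m * (2 * k), ∃ w ∈ famForms k t 1 ^ m, w.re = X ^ n := by
  induction m with
  | zero =>
    intro n hn
    obtain rfl : n = 0 := by omega
    exact ⟨1, by simp [Submodule.one_le.1], (pow_zero X).symm⟩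
  | succ m ih =>
    intro n hn
    rw [add_mul, one_mul] at hn
    obtain ⟨w, hw, hw'⟩ := ih (n - min n (2 * k)) (by omega)
    refine ⟨w * famSection k t (min n (2 * k)), ?_, ?_⟩
    · rw [pow_succ]
      exact Submodule.mul_mem_mul hw (famSection_mem_famForms k t (by omega))
    · rw [QuadraticAlgebra.re_mul, hw', famSection, zero_mul, zero_mul, add_zero, ← pow_add]
      congr 1
      omega

/-- For `i < k < j` the quadric `ω_i ω_j - ω_{i+1} ω_{j-1}` is exactly `x^{k+1+i+j} ε`; multiplying
these by further sections gives every `x^j ε` that lies in the section ring. -/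
theorem X_pow_eps_mem_pow (k : ℕ) (hk : 1 ≤ k) (t : R) (m : ℕ) (hm : 2 ≤ m) :
    ∀ j, 2 * k + 2 ≤ j → j ≤ m * (2 * k) → (⟨0, X ^ j⟩ : Fam t) ∈ famForms k t 1 ^ m := by
  induction m, hm using Nat.le_induction with
  | base =>
    intro j h1 h2
    -- `j = k + 2 + a + b` with `a < k` and `k ≤ b < 2k`
    obtain ⟨a, b, ha, hb, hb', hab⟩ :
        ∃ a b, a + 1 ≤ k ∧ k ≤ b ∧ b + 1 ≤ 2 * k ∧ j = k + 1 + a + b + 1 := by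
      rcases le_total j (3 * k + 1) with h | h
      · exact ⟨0, j - (k + 2), by omega, by omega, by omega, by omega⟩
      · exact ⟨j - (3 * k + 1), 2 * k - 1, by omega, by omega, by omega, by omega⟩
    have key : (⟨0, X ^ j⟩ : Fam t) = famSection k t a * famSection k t (b + 1) -
        famSection k t (a + 1) * famSection k t b := by
      refine QuadraticAlgebra.ext ?_ ?_
      · simp only [famSection, QuadraticAlgebra.re_sub, QuadraticAlgebra.re_mul]
        ring
      · simp only [famSection, QuadraticAlgebra.im_sub, QuadraticAlgebra.im_mul]
        rw [Nat.sub_eq_zero_of_le (show k ≤ b + 1 by omega),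
          Nat.sub_eq_zero_of_le (show k ≤ b by omega),
          show k - a = k - (a + 1) + 1 by omega, hab]
        push_cast
        ring
    rw [key, pow_two]
    exact sub_mem
      (Submodule.mul_mem_mul (famSection_mem_famForms k t (by omega))
        (famSection_mem_famForms k t (by omega)))
      (Submodule.mul_mem_mul (famSection_mem_famForms k t (by omega))
        (famSection_mem_famForms k t (by omega)))
  | succ m hm ih =>
    have hbig : ∀ j, 3 * k + 2 ≤ j → j ≤ (m + 1) * (2 * k) →
        (⟨0, X ^ j⟩ : Fam t) ∈ famForms k t 1 ^ (m + 1) := by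
      intro j h1 h2
      rw [add_mul, one_mul] at h2
      obtain ⟨a, i, ha, ha', hi, hi', rfl⟩ :
          ∃ a i, 2 * k + 2 ≤ a ∧ a ≤ m * (2 * k) ∧ k ≤ i ∧ i ≤ 2 * k ∧ j = a + i := by
        have : 2 * (2 * k) ≤ m * (2 * k) := Nat.mul_le_mul_right _ hm
        rcases le_total j (4 * k + 2) with h | h
        · exact ⟨2 * k + 2, j - (2 * k + 2), by omega, by omega, by omega, by omega, by omega⟩
        · exact ⟨j - 2 * k, 2 * k, by omega, by omega, by omega, by omega, by omega⟩
      have key : (⟨0, X ^ (a + i)⟩ : Fam t) = ⟨0, X ^ a⟩ * famSection k t i := by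
        refine QuadraticAlgebra.ext ?_ ?_
        · simp [famSection]
        · simp [famSection, Nat.sub_eq_zero_of_le hi, pow_add]
      rw [key, pow_succ]
      exact Submodule.mul_mem_mul (ih a ha ha') (famSection_mem_famForms k t hi')
    intro j h1 h2
    rcases Nat.lt_or_ge j (3 * k + 2) with h | h
    · have hj : 2 * (2 * k) ≤ m * (2 * k) := Nat.mul_le_mul_right _ hm
      have key : (⟨0, X ^ j⟩ : Fam t) = ⟨0, X ^ j⟩ * famSection k t 0 -
          (k * t) • (⟨0, X ^ (j + (k + 1))⟩ : Fam t) := by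
        refine QuadraticAlgebra.ext ?_ ?_
        · simp [famSection]
        · simp only [famSection, QuadraticAlgebra.im_sub, QuadraticAlgebra.im_mul,
            QuadraticAlgebra.im_smul, Polynomial.smul_eq_C_mul, map_mul, map_natCast]
          simp only [Nat.sub_zero, pow_add, pow_zero]
          ring
      rw [key]
      refine sub_mem ?_ (Submodule.smul_mem _ _ (hbig _ (by omega) ?_))
      · rw [pow_succ]
        exact Submodule.mul_mem_mul (ih j h1 (by omega)) (famSection_mem_famForms k t (by omega))
      · rw [add_mul]
        omega
    · exact hbig j h h2

/-- Projective normality over an arbitrary base. A lift of `f₀` to a form of degree `m` reduces the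
claim to the case `f₀ = 0`, which is `X_pow_eps_mem_pow`. -/
theorem famForms_one_pow (k : ℕ) (hk : 1 ≤ k) (t : R) (m : ℕ) :
    famForms k t 1 ^ m = famForms k t m := by
  have ih : ∀ m, famForms k t 1 ^ m ≤ famForms k t m := by
    intro m
    induction m with
    | zero =>
      rw [pow_zero, Submodule.one_le, mem_famForms]
      change (1 : R[X]).degree ≤ _ ∧ (0 : R[X]).degree ≤ _ ∧
        _ ∣ (0 : R[X]) - _ * (_ * (1 : R[X]) - _ * derivative (1 : R[X]))
      simp
    | succ m ih =>
      rw [pow_succ]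
      exact (mul_le_mul' ih le_rfl).trans (famForms_mul_le k t m 1)
  refine le_antisymm (ih m) ?_
  intro w hw
  rcases Nat.eq_zero_or_pos m with rfl | hm
  · rw [mem_famForms_iff_coeff] at hw
    obtain ⟨h1, h2, h3⟩ := hw
    have : w = w.re.coeff 0 • (1 : Fam t) := by
      refine QuadraticAlgebra.ext ?_ ?_
      · change w.re = w.re.coeff 0 • (1 : R[X])
        rw [Polynomial.smul_eq_C_mul, mul_one]
        exact eq_C_of_degree_le_zero ((degree_le_iff_coeff_zero _ _).2 fun n hn => h1 n (by
          simpa using hn))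
      · change w.im = w.re.coeff 0 • (0 : R[X])
        rw [smul_zero]
        ext n
        rcases Nat.eq_zero_or_pos n with rfl | hn
        · rw [h3 0 (by omega), if_neg (by omega), coeff_zero]
        · rw [h2 n (by omega), coeff_zero]
    rw [this, pow_zero]
    exact Submodule.smul_mem _ _ (Submodule.one_le.1 le_rfl)
  rcases Nat.lt_or_ge m 2 with hm' | hm'
  · obtain rfl : m = 1 := by omega
    rwa [pow_one]
  choose! v hv hv' using exists_re_eq_X_pow k t m
  -- `w'` has the same reduction modulo `ε` as `w`
  set w' := ∑ i ∈ Finset.range (m * (2 * k) + 1), w.re.coeff i • v i with hw'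
  have hmem : w' ∈ famForms k t 1 ^ m := Submodule.sum_mem _ fun i hi =>
    Submodule.smul_mem _ _ (hv i (Nat.lt_succ_iff.1 (Finset.mem_range.1 hi)))
  have hre : w'.re = w.re := by
    have := w.re.as_sum_range_C_mul_X_pow' (n := m * (2 * k) + 1) (by
      rw [Nat.lt_succ_iff, natDegree_le_iff_coeff_eq_zero]
      exact fun n hn => (mem_famForms_iff_coeff.1 hw).1 n (by omega))
    rw [hw', re_sum]
    conv_rhs => rw [this]
    refine Finset.sum_congr rfl fun i hi => ?_
    rw [QuadraticAlgebra.re_smul, hv' i (Nat.lt_succ_iff.1 (Finset.mem_range.1 hi)),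
      Polynomial.smul_eq_C_mul]
  have hsub := mem_famForms_iff_coeff.1 (sub_mem hw (ih m hmem))
  rw [QuadraticAlgebra.re_sub, QuadraticAlgebra.im_sub, hre, sub_self] at hsub
  obtain ⟨-, h2, h3⟩ := hsub
  simp only [coeff_zero, mul_zero, ite_self] at h3
  have hdiff : w - w' = ∑ i ∈ Finset.range (m * (2 * k) + 1),
      (w.im - w'.im).coeff i • (⟨0, X ^ i⟩ : Fam t) := by
    refine QuadraticAlgebra.ext ?_ ?_
    · rw [re_sum, QuadraticAlgebra.re_sub, hre]
      simp
    · rw [im_sum, QuadraticAlgebra.im_sub]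
      refine ((w.im - w'.im).as_sum_range_C_mul_X_pow' (n := m * (2 * k) + 1) ?_).trans ?_
      · rw [Nat.lt_succ_iff, natDegree_le_iff_coeff_eq_zero]
        exact fun n hn => h2 n (by omega)
      · simp [Polynomial.smul_eq_C_mul]
  rw [← sub_add_cancel w w', hdiff]
  refine add_mem (Submodule.sum_mem _ fun i hi => ?_) hmem
  rcases Nat.lt_or_ge i (2 * k + 2) with h | h
  · rw [h3 i h, zero_smul]
    exact zero_mem _
  · exact Submodule.smul_mem _ _ (X_pow_eps_mem_pow k hk t m hm' i h
      (Nat.lt_succ_iff.1 (Finset.mem_range.1 hi)))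

/-- The forms of degree `m` in the sections fill up `famForms k t m`. -/
theorem map_homogeneousSubmodule_famSection (k : ℕ) (hk : 1 ≤ k) (t : R) (m : ℕ) :
    (MvPolynomial.homogeneousSubmodule (Fin (2 * k + 1)) R m).map
      (MvPolynomial.aeval fun i : Fin (2 * k + 1) => famSection k t i).toLinearMap =
      famForms k t m := by
  rw [← MvPolynomial.homogeneousSubmodule_one_pow, Submodule.map_pow,
    MvPolynomial.homogeneousSubmodule_one_eq_span_X, Submodule.map_span, ← famForms_one_pow k hk,
    famForms_one, ← Set.range_comp]
  congr 3
  ext i : 1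
  simp

end Family

/-! ### The curves `C_t` -/

theorem IsNormalEmbedding.of_map_forms {n : ℕ} {B : Type*} [CommRing B] [Algebra ℂ B]
    {s : Fin n → B} {H : ℕ → Submodule ℂ B} (hs : LinearIndependent ℂ s)
    (hH : ∀ m : ℕ, (MvPolynomial.homogeneousSubmodule (Fin n) ℂ m).map
      (MvPolynomial.aeval s).toLinearMap = H m) : IsNormalEmbedding s H where
  linearIndependent := hs
  map_forms := hH
  span_eq := by
    rw [← hH 1, MvPolynomial.homogeneousSubmodule_one_eq_span_X, Submodule.map_span,
      ← Set.range_comp]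
    congr 2
    ext i : 1
    simp

theorem jet_eq_jet_iff {g : ℕ} {p q : ℂ[X]} : jet g p = jet g q ↔ X ^ (g + 1) ∣ p - q := by
  rw [← Ideal.mem_span_singleton]
  exact Ideal.Quotient.eq

theorem jet_surjective (g : ℕ) : Function.Surjective (jet g) := Ideal.Quotient.mk_surjective

theorem crimp_glue (k : ℕ) (t : ℂ) (q : ℂ[X]) :
    (crimp k t).glue (2 * k + 1) q =
      jet (2 * k + 1) (q - Polynomial.C t * X ^ (k + 2) * derivative q) := by
  have h : (jet (2 * k + 1) (-(Polynomial.C t * X ^ (k + 2)))) ^ 2 = 0 := by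
    rw [← map_pow, ← map_zero (jet (2 * k + 1)), jet_eq_jet_iff]
    exact ⟨Polynomial.C t ^ 2 * X ^ 2, by ring⟩
  have hX : ∀ p : ℂ[X], aeval (jet (2 * k + 1) X) p = jet (2 * k + 1) p := fun p => by
    rw [aeval_algHom_apply, aeval_X_left_apply]
  change aeval (jet (2 * k + 1) (X - Polynomial.C t * X ^ (k + 2))) q = _
  rw [sub_eq_add_neg, map_add, aeval_add_of_sq_eq_zero _ _ _ h, hX, hX,
    ← map_mul, ← map_add]
  congr 1
  ring

/-- The gluing datum of the dualizing bundle of `C_t`. -/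
def canonicalDatum (k : ℕ) (t : ℂ) : Jet (2 * k + 1) :=
  1 + jet (2 * k + 1) (Polynomial.C (t * (k : ℂ)) * X ^ (k + 1))

theorem canonicalDatum_pow (k : ℕ) (t : ℂ) (m : ℕ) :
    canonicalDatum k t ^ m =
      jet (2 * k + 1) (1 + Polynomial.C t * ((m * k : ℕ) : ℂ[X]) * X ^ (k + 1)) := by
  induction m with
  | zero => simp
  | succ m ih =>
    rw [pow_succ, ih, canonicalDatum, ← map_one (jet (2 * k + 1)), ← map_add, ← map_mul,
      jet_eq_jet_iff]
    refine ⟨Polynomial.C t ^ 2 * m * k ^ 2, ?_⟩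
    simp only [map_mul, map_natCast]
    push_cast
    ring

theorem mem_sections_iff (k : ℕ) (t : ℂ) (d m : ℕ) (s : ℂ[X] × ℂ[X]) :
    s ∈ (crimp k t).sections (2 * k + 1) d (canonicalDatum k t ^ m) ↔
      s.1.degree ≤ d ∧ s.2.degree ≤ d ∧ X ^ (2 * k + 2) ∣ s.1 - s.2 -
        Polynomial.C t * (X ^ (k + 1) * (((m * k : ℕ) : ℂ[X]) * s.2 - X * derivative s.2)) := by
  refine and_congr_right fun _ => and_congr_right fun _ => ?_
  rw [crimp_glue, canonicalDatum_pow, ← map_mul, jet_eq_jet_iff]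
  refine dvd_iff_dvd_of_dvd_sub
    ⟨Polynomial.C t ^ 2 * ((m * k : ℕ) : ℂ[X]) * X * derivative s.2, ?_⟩
  ring

/-- The pair of functions on the two components that an element of `Fam t` stands for. -/
def toCurve (t : ℂ) : Fam t →ₐ[ℂ] ℂ[X] × ℂ[X] where
  toFun w := (w.re + Polynomial.C t * w.im, w.re)
  map_one' := by
    change ((1 : ℂ[X]) + _ * (0 : ℂ[X]), (1 : ℂ[X])) = 1
    simp
  map_zero' := by simp
  map_mul' a b := by
    ext1
    · simp only [QuadraticAlgebra.re_mul, QuadraticAlgebra.im_mul, Prod.fst_mul]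
      ring
    · simp
  map_add' a b := by
    ext1
    · simp only [QuadraticAlgebra.re_add, QuadraticAlgebra.im_add, Prod.fst_add]
      ring
    · simp
  commutes' r := by
    change ((algebraMap ℂ ℂ[X] r) + _ * (0 : ℂ[X]), (algebraMap ℂ ℂ[X] r)) = _
    simp

theorem toCurve_apply (t : ℂ) (w : Fam t) :
    toCurve t w = (w.re + Polynomial.C t * w.im, w.re) := rfl

theorem toCurve_injective {t : ℂ} (ht : t ≠ 0) : Function.Injective (toCurve t) := by
  intro a b h
  simp only [toCurve_apply, Prod.mk.injEq] at h
  obtain ⟨h1, h2⟩ := h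
  rw [h2, add_right_inj] at h1
  exact QuadraticAlgebra.ext h2 (mul_left_cancel₀ (Polynomial.C_ne_zero.2 ht) h1)

theorem toCurve_famSection (k : ℕ) (t : ℂ) (i : Fin (2 * k + 1)) :
    toCurve t (famSection k t i) = omega k t i := by
  rw [toCurve_apply, famSection, omega]
  split_ifs with h
  · rw [← Nat.cast_sub h.le, ← Polynomial.C_eq_natCast, map_mul, mul_assoc]
  · rw [Nat.sub_eq_zero_of_le (not_lt.1 h)]
    simp

theorem aeval_omega (k : ℕ) (t : ℂ) :
    MvPolynomial.aeval (omega k t) = (toCurve t).comp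
      (MvPolynomial.aeval fun i : Fin (2 * k + 1) => famSection k t i) := by
  ext i : 1
  simp only [AlgHom.comp_apply, MvPolynomial.aeval_X, toCurve_famSection]

theorem map_toCurve_famForms (k : ℕ) {t : ℂ} (ht : t ≠ 0) (m : ℕ) :
    (famForms k t m).map (toCurve t).toLinearMap =
      (crimp k t).sections (2 * k + 1) (m * (2 * k)) (canonicalDatum k t ^ m) := by
  have hu : Polynomial.C t⁻¹ * Polynomial.C t = 1 := by
    rw [← map_mul, inv_mul_cancel₀ ht, map_one]
  ext s
  rw [mem_sections_iff]
  constructor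
  · rintro ⟨w, ⟨h1, h2, h3⟩, rfl⟩
    refine ⟨(degree_add_le _ _).trans (max_le h1 ?_), h1, ?_⟩
    · rw [← Polynomial.smul_eq_C_mul]
      exact (degree_smul_le _ _).trans h2
    · convert dvd_mul_of_dvd_right h3 (Polynomial.C t) using 1
      simp only [AlgHom.toLinearMap_apply, toCurve_apply]
      ring
  · rintro ⟨h1, h2, h3⟩
    refine ⟨⟨s.2, Polynomial.C t⁻¹ * (s.1 - s.2)⟩, ⟨h2, ?_, ?_⟩, ?_⟩
    · rw [← Polynomial.smul_eq_C_mul]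
      exact (degree_smul_le _ _).trans ((degree_sub_le _ _).trans (max_le h1 h2))
    · convert dvd_mul_of_dvd_right h3 (Polynomial.C t⁻¹) using 1
      linear_combination X ^ (k + 1) * (((m * k : ℕ) : ℂ[X]) * s.2 - X * derivative s.2) * hu
    · ext1
      · simp only [AlgHom.toLinearMap_apply, toCurve_apply]
        linear_combination (s.1 - s.2) * hu
      · rfl

theorem linearIndependent_X_pow (n : ℕ) :
    LinearIndependent ℂ fun i : Fin n => (X : ℂ[X]) ^ (i : ℕ) := by
  have h := (Polynomial.basisMonomials ℂ).linearIndependent.comp _ (Fin.val_injective (n := n))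
  convert h using 2 with i
  simp [X_pow_eq_monomial]

theorem isNormalEmbedding_omega (k : ℕ) (hk : 1 ≤ k) {t : ℂ} (ht : t ≠ 0) :
    IsNormalEmbedding (omega k t) fun m : ℕ =>
      (crimp k t).sections (2 * k + 1) (m * (2 * k)) (canonicalDatum k t ^ m) := by
  refine .of_map_forms ?_ fun m => ?_
  · refine LinearIndependent.of_comp (LinearMap.snd ℂ ℂ[X] ℂ[X]) ?_
    convert linearIndependent_X_pow (2 * k + 1) using 2 with i
    simp only [omega, Function.comp_apply, LinearMap.snd_apply]
    split_ifs <;> rfl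
  · rw [aeval_omega, AlgHom.comp_toLinearMap, Submodule.map_comp,
      map_homogeneousSubmodule_famSection k hk, map_toCurve_famForms k ht]

theorem isCanonicalDatum_canonicalDatum (k : ℕ) (hk : 1 ≤ k) {t : ℂ} (ht : t ≠ 0) :
    (crimp k t).IsCanonicalDatum (2 * k + 1) (canonicalDatum k t) := by
  have h := isNormalEmbedding_omega k hk ht
  refine ⟨⟨jet _ (Polynomial.C (t * (k : ℂ)) * X ^ k), ?_⟩, ?_⟩
  · rw [canonicalDatum, ← map_mul]
    congr 2
    ring
  · have hspan := h.span_eq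
    simp only [one_mul, pow_one] at hspan
    change Module.finrank ℂ ((crimp k t).sections (2 * k + 1) (2 * k) (canonicalDatum k t)) = _
    rw [← hspan, finrank_span_eq_card h.linearIndependent, Fintype.card_fin]

/-- If the sections form a space of dimension `g`, then every polynomial `q` of degree less than
`g` occurs as second component, because the second component determines the first one. -/
theorem exists_section_of_isCanonicalDatum {k : ℕ} {γ : Crimping} {κ : Jet (2 * k + 1)}
    (h : γ.IsCanonicalDatum (2 * k + 1) κ) {q : ℂ[X]} (hq : q.degree ≤ (2 * k : ℕ)) :
    ∃ p : ℂ[X], p.degree ≤ (2 * k : ℕ) ∧ jet (2 * k + 1) p = κ * γ.glue (2 * k + 1) q := by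
  have hdim : Module.finrank ℂ (γ.sections (2 * k + 1) (2 * k) κ) = 2 * k + 1 := h.2
  have hdeg : ∀ p : ℂ[X], p.degree ≤ (2 * k : ℕ) ↔ p ∈ degreeLT ℂ (2 * k + 1) := fun p => by
    rw [mem_degreeLT, degree_lt_iff_coeff_zero, degree_le_iff_coeff_zero]
    simp only [Nat.cast_lt, Nat.succ_le_iff]
  let φ : γ.sections (2 * k + 1) (2 * k) κ →ₗ[ℂ] degreeLT ℂ (2 * k + 1) :=
    (LinearMap.snd ℂ ℂ[X] ℂ[X]).restrict fun s hs => (hdeg _).1 hs.2.1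
  have hinj : Function.Injective φ := by
    rw [← LinearMap.ker_eq_bot, LinearMap.ker_eq_bot']
    rintro ⟨⟨p, q⟩, h1, h2, h3⟩ hs
    obtain rfl : q = 0 := congrArg Subtype.val hs
    rw [map_zero, mul_zero, ← map_zero (jet (2 * k + 1)), jet_eq_jet_iff, sub_zero,
      X_pow_dvd_iff] at h3
    have hp : p = 0 := by
      ext n
      rcases Nat.lt_or_ge n (2 * k + 1 + 1) with hn | hn
      · rw [h3 n hn, coeff_zero]
      · rw [(degree_le_iff_coeff_zero _ _).1 h1 n (Nat.cast_lt.2 (by omega)), coeff_zero]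
    subst hp
    rfl
  have : Module.Finite ℂ (γ.sections (2 * k + 1) (2 * k) κ) :=
    Module.finite_of_finrank_pos (by omega)
  have : Module.Finite ℂ (degreeLT ℂ (2 * k + 1)) :=
    Module.Finite.equiv (degreeLTEquiv ℂ (2 * k + 1)).symm
  have hsurj := (LinearMap.injective_iff_surjective_of_finrank_eq_finrank (by
    rw [hdim, (degreeLTEquiv ℂ (2 * k + 1)).finrank_eq, Module.finrank_fin_fun])).1 hinj
  obtain ⟨⟨⟨p, q'⟩, h1, h2, h3⟩, hs⟩ := hsurj ⟨q, (hdeg q).1 hq⟩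
  obtain rfl : q' = q := congrArg Subtype.val hs
  exact ⟨p, h1, h3⟩

/-- The first component of a section has no term in `x^g`, so the coefficient of `x^g` in
`κ (x - t x^{k+2})^i` vanishes for `0 ≤ i ≤ 2k`; this determines the coefficients of `κ` one by one. -/
theorem eq_canonicalDatum_of_isCanonicalDatum {k : ℕ} {t : ℂ} {κ : Jet (2 * k + 1)}
    (h : (crimp k t).IsCanonicalDatum (2 * k + 1) κ) : κ = canonicalDatum k t := by
  obtain ⟨r, hr⟩ := h.1
  obtain ⟨r, rfl⟩ := jet_surjective _ r
  rw [← map_one (jet (2 * k + 1)), ← map_mul, ← map_add] at hr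
  subst hr
  set K : ℂ[X] := 1 + X * r with hK
  have hK0 : K.coeff 0 = 1 := by simp [hK]
  rw [canonicalDatum, ← map_one (jet (2 * k + 1)), ← map_add, jet_eq_jet_iff, X_pow_dvd_iff]
  have key : ∀ i ≤ 2 * k, K.coeff (2 * k + 1 - i) = if i ≤ k then t * i * K.coeff (k - i) else 0 := by
    intro i hi
    obtain ⟨p, hp, hp'⟩ := exists_section_of_isCanonicalDatum h (q := X ^ i)
      ((degree_X_pow_le _).trans (Nat.cast_le.2 hi))
    rw [crimp_glue, ← map_mul, jet_eq_jet_iff, X_pow_dvd_iff] at hp'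
    have h1 := hp' (2 * k + 1) (by omega)
    have h2 : X ^ i - Polynomial.C t * X ^ (k + 2) * derivative (X ^ i) =
        X ^ i - Polynomial.C (t * i) * X ^ (k + 1 + i) := by
      rcases i with _ | i
      · simp
      · rw [derivative_X_pow, map_mul]
        simp only [Nat.add_sub_cancel]
        ring
    rw [h2, coeff_sub, (degree_le_iff_coeff_zero _ _).1 hp _ (Nat.cast_lt.2 (by omega)), mul_sub,
      coeff_sub, coeff_mul_X_pow', if_pos (by omega), mul_left_comm, coeff_C_mul,
      coeff_mul_X_pow'] at h1
    rw [zero_sub, neg_eq_zero, sub_eq_zero] at h1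
    rw [h1]
    split_ifs with h3 h4 h4
    · congr 2
      omega
    · omega
    · omega
    · simp
  intro n hn
  clear_value K
  rw [coeff_sub, coeff_add, coeff_C_mul, coeff_X_pow, coeff_one, sub_eq_zero]
  rcases Nat.eq_zero_or_pos n with rfl | hn0
  · simp [hK0]
  · have h1 := key (2 * k + 1 - n) (by omega)
    rw [show 2 * k + 1 - (2 * k + 1 - n) = n by omega] at h1
    rw [h1, if_neg (show ¬n = 0 by omega), zero_add]
    rcases lt_trichotomy n (k + 1) with h2 | rfl | h2
    · rw [if_neg (by omega), if_neg (by omega), mul_zero]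
    · rw [if_pos (by omega), if_pos rfl, show 2 * k + 1 - (k + 1) = k by omega, Nat.sub_self, hK0]
    · -- here the coefficient is a multiple of one of the coefficients of `x, …, x^k`, which vanish
      have h3 := key (2 * k + 1 - (k - (2 * k + 1 - n))) (by omega)
      rw [show 2 * k + 1 - (2 * k + 1 - (k - (2 * k + 1 - n))) = k - (2 * k + 1 - n) by omega,
        if_neg (by omega)] at h3
      rw [if_pos (by omega), if_neg (by omega), h3, mul_zero, mul_zero]

/-! ### The ribbon -/

theorem coeff_toLaurent_natCast (p : ℂ[X]) (n : ℕ) : (toLaurent p).coeff (n : ℤ) = p.coeff n := by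
  rw [coeff_toLaurent]
  exact Finsupp.mapDomain_apply Nat.cast_injective _ _

theorem coeff_toLaurent_of_neg (p : ℂ[X]) {e : ℤ} (he : e < 0) : (toLaurent p).coeff e = 0 := by
  rw [coeff_toLaurent]
  refine Finsupp.mapDomain_of_notMem_range _ _ ?_
  rintro ⟨n, hn⟩
  have : (n : ℤ) = e := hn
  omega

theorem coeff_T_mul (N e : ℤ) (p : ℂ[T;T⁻¹]) : (T N * p).coeff e = p.coeff (e - N) := by
  conv_lhs => rw [← add_sub_cancel N e]
  exact (AddMonoidAlgebra.coeff_single_mul_add p 1 N (e - N)).trans (one_mul _)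

theorem fst_restrict (f : Chart) : (restrict f).fst = toLaurent f.fst := by
  rw [restrict, DualNumber.lift_apply_apply]
  simp

theorem snd_restrict (f : Chart) : (restrict f).snd = toLaurent f.snd := by
  rw [restrict, DualNumber.lift_apply_apply]
  simp

theorem restrict_injective : Function.Injective restrict := by
  intro a b h
  refine TrivSqZeroExt.ext (toLaurent_injective ?_) (toLaurent_injective ?_)
  · rw [← fst_restrict, ← fst_restrict, h]
  · rw [← snd_restrict, ← snd_restrict, h]

/-- Substitution of `x = v⁻¹` in a polynomial. -/
def atInv : ℂ[X] →ₐ[ℂ] ℂ[T;T⁻¹] := aeval (T (-1))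

theorem atInv_eq_invert (p : ℂ[X]) : atInv p = invert (toLaurent p) := by
  have : atInv = (invert : ℂ[T;T⁻¹] ≃ₐ[ℂ] ℂ[T;T⁻¹]).toAlgHom.comp toLaurentAlg := by
    ext
    simp [atInv]
  rw [this]
  rfl

theorem atInv_X_pow (n : ℕ) : atInv (X ^ n) = T (-(n : ℤ)) := by
  rw [map_pow, atInv, aeval_X, T_pow, mul_neg_one]

theorem coeff_T_mul_atInv (N e : ℤ) (p : ℂ[X]) :
    (T N * atInv p).coeff e = (toLaurent p).coeff (N - e) := by
  rw [coeff_T_mul, atInv_eq_invert, invert_apply, neg_sub]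

theorem atInv_injective : Function.Injective atInv := by
  intro p q h
  rw [atInv_eq_invert, atInv_eq_invert] at h
  exact toLaurent_injective (invert.injective h)

theorem ribbonGlue_restrict (k : ℕ) (f : Chart) :
    ribbonGlue k (restrict f) = TrivSqZeroExt.inl (atInv f.fst) +
      TrivSqZeroExt.inr (atInv (derivative f.fst) * T (-(k : ℤ) - 2) +
        atInv f.snd * T (-(2 * (k : ℤ)) - 2)) := by
  have hsq : (TrivSqZeroExt.inr (T (-(k : ℤ) - 2)) : Overlap) ^ 2 = 0 := by
    rw [pow_two, TrivSqZeroExt.inr_mul_inr]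
  have hinl : ∀ p : ℂ[X], aeval (TrivSqZeroExt.inl (T (-1)) : Overlap) p =
      TrivSqZeroExt.inl (atInv p) := fun p =>
    aeval_algHom_apply (TrivSqZeroExt.inlAlgHom ℂ ℂ[T;T⁻¹] ℂ[T;T⁻¹]) (T (-1)) p
  have hglue : ∀ p : ℂ[X], glueHom k (TrivSqZeroExt.inl (toLaurent p)) =
      TrivSqZeroExt.inl (atInv p) +
        TrivSqZeroExt.inl (atInv (derivative p)) * TrivSqZeroExt.inr (T (-(k : ℤ) - 2)) := by
    intro p
    have h1 : (glueHom k).comp ((TrivSqZeroExt.inlAlgHom ℂ ℂ[T;T⁻¹] ℂ[T;T⁻¹]).comp toLaurentAlg) =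
        aeval (TrivSqZeroExt.inl (T (-1)) + TrivSqZeroExt.inr (T (-(k : ℤ) - 2)) : Overlap) := by
      ext1
      simp only [AlgHom.comp_apply, toLaurentAlg_apply, toLaurent_X, aeval_X]
      exact (glueHom_inl_T k 1).trans (by rw [zpow_one]; rfl)
    rw [← hinl, ← hinl, ← aeval_add_of_sq_eq_zero _ _ _ hsq, ← h1]
    rfl
  have hf : restrict f = TrivSqZeroExt.inl (toLaurent f.fst) +
      TrivSqZeroExt.inr (toLaurent f.snd) := by
    ext1 <;> simp [fst_restrict, snd_restrict]
  change glueHom k (restrict f) = _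
  rw [hf, map_add, glueHom_inr, hglue, hglue]
  ext1
  · simp
  · simp only [TrivSqZeroExt.snd_add, TrivSqZeroExt.snd_mul, TrivSqZeroExt.fst_add,
      TrivSqZeroExt.fst_mul, TrivSqZeroExt.fst_inl, TrivSqZeroExt.fst_inr, TrivSqZeroExt.snd_inl,
      TrivSqZeroExt.snd_inr, smul_eq_mul, MulOpposite.smul_eq_mul_unop, MulOpposite.unop_op]
    ring_nf

theorem lderiv_T (n : ℤ) : lderiv (T n) = LaurentPolynomial.C (n : ℂ) * T (n - 1) := by
  rw [lderiv]
  refine (Finsupp.sum_single_index (by simp)).trans ?_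
  rw [mul_one]

theorem ribbonOmega_eq (k : ℕ) : ribbonOmega k =
    TrivSqZeroExt.inl (-T (2 * (k : ℤ))) + TrivSqZeroExt.inr ((k : ℂ[T;T⁻¹]) * T ((k : ℤ) - 1)) := by
  rw [ribbonOmega, adjunctionFactor, lderiv_T, lderiv_T, lderiv_T]
  congr 2
  · have h : (T (2 * (k : ℤ) + 1 + 1) * T (-2) : ℂ[T;T⁻¹]) = T (2 * (k : ℤ)) := by
      rw [← T_add]; congr 1; ring
    push_cast
    rw [map_neg, map_one]
    linear_combination -h
  · have h : (T (2 * (k : ℤ) + 1 + 1) ^ 2 * (T (-(k : ℤ) - 2 - 1) * T (-(2 * (k : ℤ) + 1) - 1)) :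
        ℂ[T;T⁻¹]) = T ((k : ℤ) - 1) := by
      rw [T_pow, ← T_add, ← T_add]; congr 1; push_cast; ring
    have h' : (T (-(k : ℤ) - 2) * T (-(2 * (k : ℤ) + 1) - 1 - 1) : ℂ[T;T⁻¹]) =
        T (-(k : ℤ) - 2 - 1) * T (-(2 * (k : ℤ) + 1) - 1) := by
      rw [← T_add, ← T_add]; congr 1; ring
    push_cast
    simp only [map_neg, map_sub, map_add, map_mul, map_natCast, map_one, map_ofNat]
    linear_combination (k : ℂ[T;T⁻¹]) * h +
      T (2 * (k : ℤ) + 1 + 1) ^ 2 * (2 * k + 1 + 1) * h'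

theorem ribbonOmega_pow (k m : ℕ) : ribbonOmega k ^ m =
    TrivSqZeroExt.inl ((-1) ^ m * T (m * (2 * (k : ℤ)))) -
      TrivSqZeroExt.inr ((-1) ^ m * ((m * k : ℕ) : ℂ[T;T⁻¹]) *
        T (m * (2 * (k : ℤ)) - (k : ℤ) - 1)) := by
  induction m with
  | zero => simp
  | succ m ih =>
    rw [pow_succ, ih, ribbonOmega_eq]
    ext1
    · simp only [TrivSqZeroExt.fst_mul, TrivSqZeroExt.fst_sub, TrivSqZeroExt.fst_add,
        TrivSqZeroExt.fst_inl, TrivSqZeroExt.fst_inr, add_zero, sub_zero]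
      rw [show ((m + 1 : ℕ) : ℤ) * (2 * (k : ℤ)) = m * (2 * (k : ℤ)) + 2 * k by push_cast; ring,
        T_add]
      ring
    · simp only [TrivSqZeroExt.snd_mul, TrivSqZeroExt.fst_add, TrivSqZeroExt.fst_sub,
        TrivSqZeroExt.snd_add, TrivSqZeroExt.snd_sub, TrivSqZeroExt.fst_inl, TrivSqZeroExt.fst_inr,
        TrivSqZeroExt.snd_inl, TrivSqZeroExt.snd_inr, add_zero, sub_zero, zero_sub, zero_add,
        smul_eq_mul, MulOpposite.smul_eq_mul_unop, MulOpposite.unop_op]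
      rw [show ((m + 1 : ℕ) : ℤ) * (2 * (k : ℤ)) - k - 1 = m * (2 * (k : ℤ)) + (k - 1) by
        push_cast; ring, T_add,
        show (T (m * (2 * (k : ℤ)) - k - 1) : ℂ[T;T⁻¹]) =
          T (m * (2 * (k : ℤ))) * T (-(k : ℤ) - 1) by rw [← T_add]; congr 1; ring]
      have h : (T (-(k : ℤ) - 1) * T (2 * (k : ℤ)) : ℂ[T;T⁻¹]) = T ((k : ℤ) - 1) := by
        rw [← T_add]; congr 1; ring
      push_cast
      linear_combination ((-1) ^ m * (m * k) * T (m * (2 * (k : ℤ)))) * h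

theorem mem_ribbonSections {k m : ℕ} {s : Chart × Chart} : s ∈ ribbonSections k m ↔
    restrict s.2 = ribbonOmega k ^ m * ribbonGlue k (restrict s.1) := Iff.rfl

theorem mem_ribbonSections_iff {k m : ℕ} {s : Chart × Chart} : s ∈ ribbonSections k m ↔
    toLaurent s.2.fst = (-1) ^ m * (T (m * (2 * (k : ℤ))) * atInv s.1.fst) ∧
    toLaurent s.2.snd = (-1) ^ m * (T (m * (2 * (k : ℤ)) - k - 2) * atInv (derivative s.1.fst) +
      T (m * (2 * (k : ℤ)) - 2 * k - 2) * atInv s.1.snd -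
      ((m * k : ℕ) : ℂ[T;T⁻¹]) * (T (m * (2 * (k : ℤ)) - k - 1) * atInv s.1.fst)) := by
  rw [mem_ribbonSections, ribbonOmega_pow, ribbonGlue_restrict, TrivSqZeroExt.ext_iff,
    fst_restrict, snd_restrict]
  simp only [TrivSqZeroExt.snd_mul, TrivSqZeroExt.fst_add, TrivSqZeroExt.fst_sub,
    TrivSqZeroExt.snd_add, TrivSqZeroExt.snd_sub, TrivSqZeroExt.fst_inl, TrivSqZeroExt.fst_inr,
    TrivSqZeroExt.snd_inl, TrivSqZeroExt.snd_inr, add_zero, sub_zero, zero_sub, zero_add,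
    smul_eq_mul, MulOpposite.smul_eq_mul_unop, MulOpposite.unop_op, TrivSqZeroExt.fst_mul]
  rw [show (m * (2 * (k : ℤ)) - k - 2) = m * (2 * (k : ℤ)) + (-k - 2) by ring, T_add,
    show (m * (2 * (k : ℤ)) - 2 * k - 2) = m * (2 * (k : ℤ)) + (-(2 * k) - 2) by ring, T_add]
  refine and_congr (Eq.congr_right (by ring)) (Eq.congr_right (by ring))

/-- A section of a power of `ω_R` is determined by its restriction to the first chart. -/
theorem eq_of_mem_ribbonSections {k m : ℕ} {s s' : Chart × Chart} (hs : s ∈ ribbonSections k m)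
    (hs' : s' ∈ ribbonSections k m) (h : s.1 = s'.1) : s = s' := by
  refine Prod.ext h (restrict_injective ?_)
  rw [mem_ribbonSections.1 hs, mem_ribbonSections.1 hs', h]

theorem ribbonSections_mul_le (k m n : ℕ) :
    ribbonSections k m * ribbonSections k n ≤ ribbonSections k (m + n) := by
  rw [Submodule.mul_le]
  intro a ha b hb
  rw [mem_ribbonSections] at ha hb ⊢
  rw [Prod.snd_mul, Prod.fst_mul, map_mul, map_mul, map_mul, ha, hb, pow_add]
  ring

theorem ribbonSections_one_pow_le (k m : ℕ) : ribbonSections k 1 ^ m ≤ ribbonSections k m := by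
  induction m with
  | zero =>
    rw [Submodule.pow_zero, Submodule.one_le, mem_ribbonSections]
    simp
  | succ m ih =>
    rw [Submodule.pow_succ]
    exact (mul_le_mul' ih le_rfl).trans (ribbonSections_mul_le k m 1)

/-- The basis of `H⁰(R, ω_R)` to which the sections `omega` specialise; both subtractions of the
coefficients are truncated. -/
def ribbonSection (k i : ℕ) : Chart × Chart :=
  (TrivSqZeroExt.inl (X ^ (2 * k - i)) -
      TrivSqZeroExt.inr (((k - i : ℕ) : ℂ[X]) * X ^ (k - 1 - i)),
    -TrivSqZeroExt.inl (X ^ i) + TrivSqZeroExt.inr (((i - k : ℕ) : ℂ[X]) * X ^ (i - k - 1)))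

/-- The change of coordinates `x = u⁻¹` from the fibre over `t = 0` of the family to the first chart
of the ribbon; it reverses the sign of `ε`. -/
def toRibbon : Fam (0 : ℂ) →ₐ[ℂ] Overlap where
  toFun w := TrivSqZeroExt.inl (atInv w.re) - TrivSqZeroExt.inr (atInv w.im)
  map_one' := by
    change TrivSqZeroExt.inl (atInv 1) - TrivSqZeroExt.inr (atInv 0) = _
    simp
  map_zero' := by simp
  map_mul' a b := by
    ext1
    · simp
    · simp
      ring
  map_add' a b := by
    ext1
    · simp
    · simp
      ring
  commutes' r := by
    change TrivSqZeroExt.inl (atInv (algebraMap ℂ ℂ[X] r)) - TrivSqZeroExt.inr (atInv 0) = _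
    rw [AlgHom.commutes, map_zero, TrivSqZeroExt.inr_zero, sub_zero]
    rfl

theorem fst_toRibbon (w : Fam (0 : ℂ)) : (toRibbon w).fst = atInv w.re := by
  change (TrivSqZeroExt.inl (atInv w.re) - TrivSqZeroExt.inr (atInv w.im)).fst = _
  simp

theorem snd_toRibbon (w : Fam (0 : ℂ)) : (toRibbon w).snd = -atInv w.im := by
  change (TrivSqZeroExt.inl (atInv w.re) - TrivSqZeroExt.inr (atInv w.im)).snd = _
  simp

theorem toRibbon_injective : Function.Injective toRibbon := by
  intro a b h
  refine QuadraticAlgebra.ext (atInv_injective ?_) (atInv_injective (neg_injective ?_))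
  · rw [← fst_toRibbon, ← fst_toRibbon, h]
  · rw [← snd_toRibbon, ← snd_toRibbon, h]

theorem natCast_mul_T_eq_of_sub {a b : ℕ} {e e' : ℤ} (h : b < a → e = e') :
    (((a - b : ℕ) : ℂ[T;T⁻¹]) * T e) = ((a - b : ℕ) : ℂ[T;T⁻¹]) * T e' := by
  rcases Nat.lt_or_ge b a with hab | hab
  · rw [h hab]
  · rw [Nat.sub_eq_zero_of_le hab]
    simp

/-- The section `ω_i` at `t = 0` is the restriction of `ribbonSection k i`, written in the
trivialisation of `ω_R` that differs from `du ∧ dε / ε²` by `u^{2k}`. -/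
theorem restrict_ribbonSection_fst (k i : ℕ) (hi : i ≤ 2 * k) :
    restrict (ribbonSection k i).1 =
      TrivSqZeroExt.inl (T (2 * (k : ℤ))) * toRibbon (famSection k 0 i) := by
  ext1
  · rw [fst_restrict, TrivSqZeroExt.fst_mul, fst_toRibbon, TrivSqZeroExt.fst_inl, famSection,
      atInv_X_pow, ← T_add]
    simp only [ribbonSection, TrivSqZeroExt.fst_sub, TrivSqZeroExt.fst_inl, TrivSqZeroExt.fst_inr,
      sub_zero, toLaurent_X_pow]
    congr 1
    omega
  · rw [snd_restrict, TrivSqZeroExt.snd_mul, snd_toRibbon, TrivSqZeroExt.fst_inl,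
      TrivSqZeroExt.snd_inl, famSection, map_mul, atInv_X_pow, map_natCast]
    simp only [ribbonSection, TrivSqZeroExt.snd_sub, TrivSqZeroExt.snd_inl, TrivSqZeroExt.snd_inr,
      zero_sub, map_neg, map_mul, map_natCast, toLaurent_X_pow, smul_zero, add_zero, smul_eq_mul,
      mul_neg]
    rw [mul_left_comm, ← T_add, natCast_mul_T_eq_of_sub]
    intro h
    omega

theorem atInv_derivative_X_pow (n : ℕ) :
    atInv (derivative (X ^ n)) = (n : ℂ[T;T⁻¹]) * T (1 - (n : ℤ)) := by
  rcases n with _ | n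
  · simp
  · rw [derivative_X_pow, map_mul, Nat.add_sub_cancel, atInv_X_pow, Polynomial.C_eq_natCast,
      map_natCast]
    congr 2
    push_cast
    ring

theorem ribbonSection_mem (k i : ℕ) (hi : i ≤ 2 * k) : ribbonSection k i ∈ ribbonSections k 1 := by
  rw [mem_ribbonSections_iff]
  simp only [ribbonSection, TrivSqZeroExt.snd_sub, TrivSqZeroExt.snd_inl, TrivSqZeroExt.snd_inr,
    TrivSqZeroExt.fst_sub, TrivSqZeroExt.fst_inl, TrivSqZeroExt.fst_inr, TrivSqZeroExt.fst_add,
    TrivSqZeroExt.snd_add, TrivSqZeroExt.fst_neg, TrivSqZeroExt.snd_neg,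
    zero_sub, map_neg, map_mul, map_natCast, toLaurent_X_pow, sub_zero, add_zero, neg_zero,
    zero_add, atInv_X_pow, atInv_derivative_X_pow, pow_one, Nat.cast_one, one_mul]
  constructor
  · rw [← T_add, neg_one_mul]
    congr 2
    omega
  · rw [mul_left_comm, ← T_add, mul_neg, mul_left_comm, ← T_add, ← T_add,
      natCast_mul_T_eq_of_sub (a := i) (e' := (i : ℤ) - k - 1) (by omega),
      natCast_mul_T_eq_of_sub (a := k) (e' := (i : ℤ) - k - 1) (by omega)]
    rw [show 2 * (k : ℤ) - k - 2 + (1 - ((2 * k - i : ℕ) : ℤ)) = (i : ℤ) - k - 1 by omega,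
      show 2 * (k : ℤ) - k - 1 + -((2 * k - i : ℕ) : ℤ) = (i : ℤ) - k - 1 by omega]
    have h : ((i - k : ℕ) : ℂ[T;T⁻¹]) + (2 * k - i : ℕ) = (k - i : ℕ) + (k : ℕ) := by
      have h' : (i - k) + (2 * k - i) = (k - i) + k := by omega
      rw [← Nat.cast_add, h', Nat.cast_add]
    linear_combination T ((i : ℤ) - k - 1) * h

theorem inl_T_pow (k m : ℕ) : (TrivSqZeroExt.inl (T (2 * (k : ℤ))) : Overlap) ^ m =
    TrivSqZeroExt.inl (T (m * (2 * (k : ℤ)))) := by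
  rw [TrivSqZeroExt.inl_pow, T_pow]

/-- A form in the sections of the ribbon restricts to the same form in the sections of the fibre
of the family over `t = 0`. -/
theorem restrict_aeval_ribbonSection (k : ℕ) {m : ℕ} {F : MvPolynomial (Fin (2 * k + 1)) ℂ}
    (hF : F.IsHomogeneous m) :
    restrict (MvPolynomial.aeval (fun i : Fin (2 * k + 1) => ribbonSection k i) F).1 =
      TrivSqZeroExt.inl (T (m * (2 * (k : ℤ)))) *
        toRibbon (MvPolynomial.aeval (fun i : Fin (2 * k + 1) => famSection k (0 : ℂ) i) F) := by
  have h1 : (restrict.comp ((AlgHom.fst ℂ Chart Chart).comp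
      (MvPolynomial.aeval fun i : Fin (2 * k + 1) => ribbonSection k i))) =
      MvPolynomial.aeval fun i : Fin (2 * k + 1) =>
        TrivSqZeroExt.inl (T (2 * (k : ℤ))) * toRibbon (famSection k 0 i) := by
    ext1 i
    simp only [AlgHom.comp_apply, MvPolynomial.aeval_X]
    exact restrict_ribbonSection_fst k i (by omega)
  have h2 := congrArg (fun φ => φ F) h1
  refine h2.trans ?_
  rw [aeval_mul_of_isHomogeneous _ _ hF, inl_T_pow]
  congr 1
  exact (MvPolynomial.comp_aeval_apply _ toRibbon F).symm

theorem map_aeval_ribbonSection_le (k m : ℕ) :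
    (MvPolynomial.homogeneousSubmodule (Fin (2 * k + 1)) ℂ m).map
      (MvPolynomial.aeval fun i : Fin (2 * k + 1) => ribbonSection k i).toLinearMap ≤
      ribbonSections k m := by
  refine le_trans ?_ (ribbonSections_one_pow_le k m)
  rw [← MvPolynomial.homogeneousSubmodule_one_pow, Submodule.map_pow]
  refine pow_le_pow_left' ?_ m
  rw [MvPolynomial.homogeneousSubmodule_one_eq_span_X, Submodule.map_span, Submodule.span_le]
  rintro _ ⟨_, ⟨i, rfl⟩, rfl⟩
  rw [AlgHom.toLinearMap_apply, MvPolynomial.aeval_X]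
  exact ribbonSection_mem k i (by omega)

theorem aeval_ribbonSection_eq_zero_iff (k : ℕ) {m : ℕ} {F : MvPolynomial (Fin (2 * k + 1)) ℂ}
    (hF : F.IsHomogeneous m) :
    MvPolynomial.aeval (fun i : Fin (2 * k + 1) => ribbonSection k i) F = 0 ↔
      MvPolynomial.aeval (fun i : Fin (2 * k + 1) => famSection k (0 : ℂ) i) F = 0 := by
  have h := restrict_aeval_ribbonSection k hF
  constructor
  · intro h0
    rw [h0, Prod.fst_zero, map_zero] at h
    refine toRibbon_injective ?_
    have h1 := congrArg (TrivSqZeroExt.inl (T (-(m * (2 * (k : ℤ))))) * ·) h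
    simp only [mul_zero] at h1
    rw [← mul_assoc, inl_T_mul_inl_T, neg_add_cancel, T_zero, TrivSqZeroExt.inl_one, one_mul] at h1
    exact h1.symm.trans (map_zero toRibbon).symm
  · intro h0
    rw [h0, map_zero, mul_zero] at h
    refine eq_of_mem_ribbonSections
      (map_aeval_ribbonSection_le k m ⟨F, hF, rfl⟩) (zero_mem (ribbonSections k m)) ?_
    exact restrict_injective (h.trans (map_zero _).symm)

/-- The sections of `ω_Rᵐ` restrict to elements of `famForms k 0 m`: regularity on the second chart
says that the coefficients of negative powers of `v` vanish, which gives the bound on the degree and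
the congruence modulo `x^{2k+2}`. -/
theorem exists_famForms_of_mem_ribbonSections {k m : ℕ} (hk : 1 ≤ k) {s : Chart × Chart}
    (hs : s ∈ ribbonSections k m) : ∃ w ∈ famForms k (0 : ℂ) m,
      restrict s.1 = TrivSqZeroExt.inl (T (m * (2 * (k : ℤ)))) * toRibbon w := by
  rw [mem_ribbonSections_iff] at hs
  obtain ⟨h1, h2⟩ := hs
  set a := s.1.fst
  set b := s.1.snd
  set N := m * (2 * k) with hN
  have hNm : (m * (2 * (k : ℤ)) : ℤ) = (N : ℤ) := by rw [hN]; push_cast; ring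
  rw [hNm] at h1 h2 ⊢
  have hsign : ∀ p q : ℂ[T;T⁻¹], p = (-1) ^ m * q → q = (-1) ^ m * p := by
    rintro p q rfl
    rw [← mul_assoc, ← mul_pow]
    simp
  have hsgn : ∀ (p : ℂ[T;T⁻¹]) (e : ℤ), ((-1) ^ m * p).coeff e = (-1) ^ m * p.coeff e := by
    intro p e
    rcases m.even_or_odd with h | h <;> simp [h.neg_one_pow]
  have ha : ∀ n, N < n → a.coeff n = 0 := by
    intro n hn
    have h := congrArg (fun p : ℂ[T;T⁻¹] => p.coeff ((N : ℤ) - n)) (hsign _ _ h1)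
    simp only [hsgn] at h
    rwa [coeff_toLaurent_of_neg _ (by omega), mul_zero, coeff_T_mul_atInv, sub_sub_cancel,
      coeff_toLaurent_natCast] at h
  have hb : ∀ n, N < n + 2 * k + 2 →
      b.coeff n = (((m * k : ℕ) : ℂ) - (n + k + 1 : ℕ)) * a.coeff (n + k + 1) := by
    intro n hn
    have h := congrArg (fun p : ℂ[T;T⁻¹] => p.coeff ((N : ℤ) - 2 * k - 2 - n)) (hsign _ _ h2)
    rw [← nsmul_eq_mul] at h
    simp only [hsgn, AddMonoidAlgebra.coeff_sub, AddMonoidAlgebra.coeff_add,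
      AddMonoidAlgebra.coeff_smul, Finsupp.sub_apply, Finsupp.add_apply, Finsupp.smul_apply,
      coeff_T_mul_atInv] at h
    rw [coeff_toLaurent_of_neg (TrivSqZeroExt.snd s.2) (by omega), mul_zero,
      show (N : ℤ) - k - 2 - (N - 2 * k - 2 - n) = (n + k : ℕ) by push_cast; ring,
      show (N : ℤ) - 2 * k - 2 - (N - 2 * k - 2 - n) = (n : ℕ) by ring,
      show (N : ℤ) - k - 1 - (N - 2 * k - 2 - n) = (n + k + 1 : ℕ) by push_cast; ring,
      coeff_toLaurent_natCast, coeff_toLaurent_natCast, coeff_toLaurent_natCast, coeff_derivative,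
      nsmul_eq_mul] at h
    push_cast at h ⊢
    linear_combination h
  have hre : ∀ n ≤ N, (reflect N a).coeff n = a.coeff (N - n) := fun n hn => by
    rw [coeff_reflect, revAt_le hn]
  have hre' : ∀ n, N < n → (reflect N a).coeff n = 0 := fun n hn => by
    rw [coeff_reflect, revAt_eq_self_of_lt hn, ha n hn]
  have him : ∀ n ≤ N, (reflect N b).coeff n = b.coeff (N - n) := fun n hn => by
    rw [coeff_reflect, revAt_le hn]
  have him' : ∀ n, N < n → (reflect N b).coeff n = 0 := fun n hn => by
    rw [coeff_reflect, revAt_eq_self_of_lt hn, hb n (by omega), ha _ (by omega), mul_zero]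
  have hlau : ∀ p : ℂ[X], (∀ n, N < n → p.coeff n = 0) →
      toLaurent p = T (N : ℤ) * atInv (reflect N p) := by
    intro p hp
    ext e
    rw [coeff_T_mul_atInv]
    rcases lt_or_ge e 0 with he | he
    · lift N - e to ℕ using by omega with j hj
      rw [coeff_toLaurent_of_neg _ he, coeff_toLaurent_natCast, coeff_reflect,
        revAt_eq_self_of_lt (by omega), hp j (by omega)]
    lift e to ℕ using he
    rw [coeff_toLaurent_natCast]
    rcases le_or_gt e N with he | he
    · rw [← Nat.cast_sub he, coeff_toLaurent_natCast, coeff_reflect, revAt_le (Nat.sub_le N e),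
        Nat.sub_sub_self he]
    · rw [coeff_toLaurent_of_neg _ (by omega), hp e he]
  refine ⟨⟨reflect N a, -reflect N b⟩, ?_, ?_⟩
  · rw [mem_famForms_iff_coeff]
    refine ⟨hre', fun n hn => ?_, fun n hn => ?_⟩
    · rw [coeff_neg, him' n hn, neg_zero]
    · rw [coeff_neg]
      rcases le_or_gt n N with h | h
      · rw [him n h, hb _ (by omega)]
        split_ifs with h3
        · rw [hre _ (by omega), show N - n + k + 1 = N - (n - (k + 1)) by omega]
          have h4 : ((N - (n - (k + 1)) : ℕ) : ℂ) + (n - (k + 1) : ℕ) =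
              (m * k : ℕ) + (m * k : ℕ) := by
            have hN' : N = m * k + m * k := by rw [hN]; ring
            rw [← Nat.cast_add, ← Nat.cast_add]
            congr 1
            omega
          linear_combination a.coeff (N - (n - (k + 1))) * h4
        · rw [ha _ (by omega), mul_zero, neg_zero]
      · rw [him' n h, neg_zero]
        split_ifs with h3
        · -- for `m ≤ 1` some exponents below `2k + 2` exceed the degree `2km`
          rcases Nat.lt_or_ge N (n - (k + 1)) with h4 | h4
          · rw [hre' _ h4, mul_zero]
          have h5 : n - (k + 1) = m * k := by
            have hN' : N = m * k + m * k := by rw [hN]; ring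
            obtain rfl | rfl | h6 : m = 0 ∨ m = 1 ∨ 2 ≤ m := by omega
            · omega
            · omega
            · have := Nat.mul_le_mul_right k h6
              omega
          rw [h5, sub_self, zero_mul]
        · rfl
  · ext1
    · rw [fst_restrict, TrivSqZeroExt.fst_mul, fst_toRibbon, TrivSqZeroExt.fst_inl]
      exact hlau a ha
    · rw [snd_restrict, TrivSqZeroExt.snd_mul, snd_toRibbon, TrivSqZeroExt.fst_inl,
        TrivSqZeroExt.snd_inl]
      rw [smul_zero, add_zero, smul_eq_mul, map_neg, neg_neg]
      exact hlau b fun n hn => by rw [hb n (by omega), ha _ (by omega), mul_zero]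

theorem isNormalEmbedding_ribbonSection (k : ℕ) (hk : 1 ≤ k) :
    IsNormalEmbedding (fun i : Fin (2 * k + 1) => ribbonSection k i)
      fun m : ℕ => ribbonSections k m := by
  refine .of_map_forms ?_ fun m => le_antisymm (map_aeval_ribbonSection_le k m) ?_
  · let φ : Chart × Chart →ₗ[ℂ] ℂ[X] :=
      { toFun := fun s => -s.2.fst
        map_add' := fun a b => by simp [add_comm]
        map_smul' := fun c a => by simp }
    have hφ : (φ ∘ fun i : Fin (2 * k + 1) => ribbonSection k i) =
        fun i : Fin (2 * k + 1) => (X : ℂ[X]) ^ (i : ℕ) := by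
      funext i
      change -(ribbonSection k i).2.fst = X ^ (i : ℕ)
      simp [ribbonSection]
    refine LinearIndependent.of_comp φ ?_
    rw [hφ]
    exact linearIndependent_X_pow (2 * k + 1)
  · intro s hs
    obtain ⟨w, hw, hsw⟩ := exists_famForms_of_mem_ribbonSections hk hs
    rw [← map_homogeneousSubmodule_famSection k hk] at hw
    obtain ⟨F, hF, rfl⟩ := hw
    refine ⟨F, hF, eq_of_mem_ribbonSections (map_aeval_ribbonSection_le k m ⟨F, hF, rfl⟩) hs ?_⟩
    exact restrict_injective ((restrict_aeval_ribbonSection k hF).trans hsw.symm)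

/-! ### The flat limit -/

/-- Specialisation of the family over `ℂ[t]` at `t = a`. -/
def specialize (a : ℂ) : Fam (X : ℂ[X]) →+* Fam a where
  toFun w := ⟨w.re.map (evalRingHom a), w.im.map (evalRingHom a)⟩
  map_one' := by
    change (⟨(1 : ℂ[X][X]).map _, (0 : ℂ[X][X]).map _⟩ : Fam a) = ⟨1, 0⟩
    simp
  map_zero' := by
    change (⟨(0 : ℂ[X][X]).map _, (0 : ℂ[X][X]).map _⟩ : Fam a) = ⟨0, 0⟩
    simp
  map_mul' a b := by
    refine QuadraticAlgebra.ext ?_ ?_ <;> simp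
  map_add' a b := by
    refine QuadraticAlgebra.ext ?_ ?_ <;> simp

theorem specialize_apply (a : ℂ) (w : Fam (X : ℂ[X])) :
    specialize a w = ⟨w.re.map (evalRingHom a), w.im.map (evalRingHom a)⟩ := rfl

theorem specialize_aeval (k : ℕ) (a : ℂ) (F : MvPolynomial (Fin (2 * k + 1)) ℂ[X]) :
    specialize a (MvPolynomial.aeval (fun i : Fin (2 * k + 1) => famSection k (X : ℂ[X]) i) F) =
      MvPolynomial.aeval (fun i : Fin (2 * k + 1) => famSection k a i)
        (MvPolynomial.map (evalRingHom a) F) := by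
  have h : (specialize a).comp (MvPolynomial.aeval
      fun i : Fin (2 * k + 1) => famSection k (X : ℂ[X]) i).toRingHom =
      (MvPolynomial.aeval fun i : Fin (2 * k + 1) => famSection k a i).toRingHom.comp
        (MvPolynomial.map (evalRingHom a)) := by
    refine MvPolynomial.ringHom_ext (fun r => ?_) fun i => ?_
    · change specialize a (MvPolynomial.aeval _ (MvPolynomial.C r)) =
        MvPolynomial.aeval _ (MvPolynomial.map (evalRingHom a) (MvPolynomial.C r))
      rw [MvPolynomial.map_C, MvPolynomial.aeval_C, MvPolynomial.aeval_C, specialize_apply]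
      change (⟨(Polynomial.C r).map _, (0 : ℂ[X][X]).map _⟩ : Fam a) =
        ⟨Polynomial.C (evalRingHom a r), 0⟩
      rw [map_C, Polynomial.map_zero]
    · change specialize a (MvPolynomial.aeval _ (MvPolynomial.X i)) =
        MvPolynomial.aeval _ (MvPolynomial.map (evalRingHom a) (MvPolynomial.X i))
      rw [MvPolynomial.map_X, MvPolynomial.aeval_X, MvPolynomial.aeval_X, specialize_apply,
        famSection, famSection]
      simp
  exact congrArg (fun φ => φ F) h

theorem exists_eq_smul_of_specialize_eq_zero {a : ℂ} {w : Fam (X : ℂ[X])}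
    (h : specialize a w = 0) : ∃ w' : Fam (X : ℂ[X]), w = (X - Polynomial.C a) • w' := by
  have hdvd : ∀ f : ℂ[X][X], f.map (evalRingHom a) = 0 → Polynomial.C (X - Polynomial.C a) ∣ f := by
    intro f hf
    rw [C_dvd_iff_dvd_coeff]
    intro n
    rw [dvd_iff_isRoot, IsRoot, ← coe_evalRingHom, ← coeff_map, hf, coeff_zero]
  obtain ⟨p, hp⟩ := hdvd w.re (congrArg QuadraticAlgebra.re h)
  obtain ⟨q, hq⟩ := hdvd w.im (congrArg QuadraticAlgebra.im h)
  refine ⟨⟨p, q⟩, QuadraticAlgebra.ext ?_ ?_⟩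
  · rw [hp, QuadraticAlgebra.re_smul, Polynomial.smul_eq_C_mul]
  · rw [hq, QuadraticAlgebra.im_smul, Polynomial.smul_eq_C_mul]

/-- The submodule `famForms k t m` is saturated, because its defining equations are linear with
coefficients that do not depend on `t`. -/
theorem mem_famForms_of_smul_mem {R : Type*} [CommRing R] [IsDomain R] {k : ℕ} {t : R} {m : ℕ}
    {r : R} (hr : r ≠ 0) {w : Fam t} (h : r • w ∈ famForms k t m) : w ∈ famForms k t m := by
  rw [mem_famForms_iff_coeff] at h ⊢
  simp only [QuadraticAlgebra.re_smul, QuadraticAlgebra.im_smul, coeff_smul, smul_eq_mul,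
    mul_eq_zero, hr, false_or] at h
  refine ⟨h.1, h.2.1, fun n hn => ?_⟩
  have h3 := h.2.2 n hn
  split_ifs at h3 ⊢
  · rw [mul_left_comm] at h3
    exact mul_left_cancel₀ hr h3
  · simpa [hr] using h3

/-- The homogeneous ideal of the family over `ℂ[t]`: the kernel of `Z_i ↦ ω_i s`, where the
additional variable `s` keeps track of the degree. -/
def famIdeal (k : ℕ) : Ideal (MvPolynomial (Fin (2 * k + 1)) ℂ[X]) :=
  RingHom.ker (MvPolynomial.aeval fun i : Fin (2 * k + 1) =>
    (X : (Fam (X : ℂ[X]))[X]) * Polynomial.C (famSection k (X : ℂ[X]) i) :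
      MvPolynomial (Fin (2 * k + 1)) ℂ[X] →ₐ[ℂ[X]] (Fam (X : ℂ[X]))[X])

theorem mem_famIdeal_iff {k : ℕ} {F : MvPolynomial (Fin (2 * k + 1)) ℂ[X]} :
    F ∈ famIdeal k ↔ ∀ m, MvPolynomial.aeval
      (fun i : Fin (2 * k + 1) => famSection k (X : ℂ[X]) i)
        (MvPolynomial.homogeneousComponent m F) = 0 := by
  rw [famIdeal, RingHom.mem_ker, Polynomial.ext_iff]
  refine forall_congr' fun m => ?_
  conv_lhs => rw [← MvPolynomial.sum_homogeneousComponent F]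
  rw [map_sum, finsetSum_coeff, coeff_zero]
  have h : ∀ d, (MvPolynomial.aeval (fun i : Fin (2 * k + 1) =>
      (X : (Fam (X : ℂ[X]))[X]) * Polynomial.C (famSection k (X : ℂ[X]) i))
        (MvPolynomial.homogeneousComponent d F)) =
      X ^ d * Polynomial.C (MvPolynomial.aeval
        (fun i : Fin (2 * k + 1) => famSection k (X : ℂ[X]) i)
          (MvPolynomial.homogeneousComponent d F)) := by
    intro d
    rw [aeval_mul_of_isHomogeneous _ _ (MvPolynomial.homogeneousComponent_isHomogeneous d F)]
    congr 1
    exact (MvPolynomial.comp_aeval_apply _ (Polynomial.CAlgHom (R := ℂ[X])) _).symm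
  simp only [h, coeff_X_pow_mul', coeff_C]
  rw [Finset.sum_eq_single m]
  · simp
  · intro d _ hd
    rcases Nat.lt_or_ge m d with h1 | h1
    · rw [if_neg (by omega)]
    · rw [if_pos h1, if_neg (by omega)]
  · intro hm
    rw [MvPolynomial.homogeneousComponent_eq_zero _ _ (by simpa using hm), map_zero]
    simp

theorem flat_quotient_famIdeal (k : ℕ) :
    Module.Flat ℂ[X] (MvPolynomial (Fin (2 * k + 1)) ℂ[X] ⧸ famIdeal k) := by
  rw [IsDedekindDomain.flat_iff_torsion_eq_bot, ← Submodule.isTorsionFree_iff_torsion_eq_bot]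
  exact Function.Injective.moduleIsTorsionFree _ (Ideal.kerLiftAlg_injective _) (map_smul _)

theorem map_famIdeal (k : ℕ) (hk : 1 ≤ k) (a : ℂ) :
    (famIdeal k).map (MvPolynomial.map (evalRingHom a)) =
      imageIdeal fun i : Fin (2 * k + 1) => famSection k a i := by
  apply le_antisymm
  · rw [Ideal.map_le_iff_le_comap]
    intro F hF
    rw [mem_famIdeal_iff] at hF
    rw [Ideal.mem_comap, ← MvPolynomial.sum_homogeneousComponent F, map_sum]
    refine Ideal.sum_mem _ fun m _ => Ideal.subset_span ⟨⟨m, ?_⟩, ?_⟩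
    · exact (MvPolynomial.homogeneousComponent_isHomogeneous m F).map _
    · rw [← specialize_aeval, hF m, map_zero]
  · rw [imageIdeal, Ideal.span_le]
    rintro F ⟨⟨m, hF⟩, hF0⟩
    set F' : MvPolynomial (Fin (2 * k + 1)) ℂ[X] := MvPolynomial.map Polynomial.C F with hF'
    have hspec : MvPolynomial.map (evalRingHom a) F' = F := by
      rw [hF', MvPolynomial.map_map]
      convert MvPolynomial.map_id F
      ext
      simp
    have h0 : specialize a (MvPolynomial.aeval
        (fun i : Fin (2 * k + 1) => famSection k (X : ℂ[X]) i) F') = 0 := by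
      rw [specialize_aeval, hspec, hF0]
    obtain ⟨w, hw⟩ := exists_eq_smul_of_specialize_eq_zero h0
    have hwm : w ∈ famForms k (X : ℂ[X]) m := by
      refine mem_famForms_of_smul_mem (X_sub_C_ne_zero a) ?_
      rw [← hw, ← map_homogeneousSubmodule_famSection k hk]
      exact ⟨F', hF.map _, rfl⟩
    rw [← map_homogeneousSubmodule_famSection k hk] at hwm
    obtain ⟨G, hG, rfl⟩ := hwm
    -- `F' - (t - a) G` is a form that vanishes on the family and specialises to `F`
    have hmem : F' - (X - Polynomial.C a) • G ∈ famIdeal k := by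
      have hH : (F' - (X - Polynomial.C a) • G).IsHomogeneous m :=
        (hF.map _).sub ((MvPolynomial.homogeneousSubmodule _ _ m).smul_mem _ hG)
      rw [mem_famIdeal_iff]
      intro d
      rw [MvPolynomial.homogeneousComponent_of_mem hH]
      split_ifs
      · rw [map_sub, map_smul, hw]
        exact sub_self _
      · exact map_zero _
    have := Ideal.mem_map_of_mem (MvPolynomial.map (evalRingHom a)) hmem
    rwa [map_sub, hspec, MvPolynomial.smul_eq_C_mul, map_mul, MvPolynomial.map_C, map_sub,
      coe_evalRingHom, eval_X, eval_C, sub_self, map_zero, zero_mul, sub_zero] at this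

theorem imageIdeal_omega (k : ℕ) {t : ℂ} (ht : t ≠ 0) :
    imageIdeal (omega k t) = imageIdeal fun i : Fin (2 * k + 1) => famSection k t i := by
  unfold imageIdeal
  congr 1
  ext F
  refine and_congr_right fun _ => ?_
  rw [aeval_omega, AlgHom.comp_apply]
  exact map_eq_zero_iff _ (toCurve_injective ht)

theorem imageIdeal_ribbonSection (k : ℕ) :
    (imageIdeal fun i : Fin (2 * k + 1) => ribbonSection k i) =
      imageIdeal fun i : Fin (2 * k + 1) => famSection k (0 : ℂ) i := by
  unfold imageIdeal
  congr 1
  ext F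
  exact and_congr_right fun ⟨m, hF⟩ => aeval_ribbonSection_eq_zero_iff k hF

theorem isFlatLimit_omega (k : ℕ) (hk : 1 ≤ k) :
    IsFlatLimit (fun t : ℂ => imageIdeal (omega k t))
      (imageIdeal fun i : Fin (2 * k + 1) => ribbonSection k i) := by
  refine ⟨famIdeal k, fun F hF m => ?_, flat_quotient_famIdeal k, fun a ha => ?_, ?_⟩
  · rw [mem_famIdeal_iff] at hF ⊢
    intro d
    rw [MvPolynomial.homogeneousComponent_of_mem
      (MvPolynomial.homogeneousComponent_isHomogeneous m F)]
    split_ifs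
    · exact hF m
    · exact map_zero _
  · exact (map_famIdeal k hk a).trans (imageIdeal_omega k ha).symm
  · rw [map_famIdeal k hk, imageIdeal_ribbonSection]

end CanonicalRibbon

end

open CanonicalRibbon in
theorem lemma4p5 (k : ℕ) (hk : 1 ≤ k) :
    (∀ t : ℂ, t ≠ 0 →
      ∃ κ : Jet (2 * k + 1),
        κ = 1 + jet (2 * k + 1) (Polynomial.C (t * (k : ℂ)) * Polynomial.X ^ (k + 1)) ∧
        (∀ κ' : Jet (2 * k + 1), (crimp k t).IsCanonicalDatum (2 * k + 1) κ' ↔ κ' = κ) ∧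
        IsNormalEmbedding (omega k t)
          (fun m : ℕ => (crimp k t).sections (2 * k + 1) (m * (2 * k)) (κ ^ m))) ∧
    ∃ z : Fin (2 * k + 1) → Chart × Chart,
      IsNormalEmbedding z (fun m : ℕ => ribbonSections k m) ∧
      IsFlatLimit (fun t : ℂ => imageIdeal (omega k t)) (imageIdeal z) := by
  refine ⟨fun t ht => ⟨canonicalDatum k t, rfl, fun κ' => ⟨fun h => ?_, ?_⟩,
    isNormalEmbedding_omega k hk ht⟩, fun i => ribbonSection k i,
    isNormalEmbedding_ribbonSection k hk, isFlatLimit_omega k hk⟩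
  · exact eq_canonicalDatum_of_isCanonicalDatum h
  · rintro rfl
    exact isCanonicalDatum_canonicalDatum k hk ht
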